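/- Fix $c>0$, $\lambda,\delta,p_0\in(0,1)$ and $m$ with $g:=\lambda m-c>0$. A state $\theta\in\{G,B\}$ is drawn with $P(\theta=G)=p_0$. Two players move alternately, player 1 first; the mover chooses the safe arm $S$ (payoff $0$) or the risky arm $R$ ("experiments"). An experiment costs $c$; it yields $m$ ("success") with probability $\lambda$, independently across experiments, if $\theta=G$, and always yields $0$ if $\theta=B$. Choices are public, outcomes are observed only by the mover. Payoffs are discounted by $\delta$ per period, a period being two consecutive moves. A public history $h$ is a finite word in $\{R,S\}$, and $n_e(h)$ is its number of $R$'s. A private history of player $i$ consists of the public history and the outcomes of $i$'s experiments; a full history consists of $\theta$, all choices and all outcomes. A strategy assigns a mixed move to each private history at which the player is active. A belief system $\pi$ assigns to each private history a probability distribution on full histories. A pair $(\sigma,\pi)$ is a sequential equilibrium (SE) if (i) at each private history where a player is active, his strategy maximizes his expected discounted continuation payoff given his belief and the other player's strategy, and (ii) there are completely mixed profiles $\tau_n\to\sigma$ (pointwise) whose Bayesian beliefs converge pointwise to $\pi$. Let $p^i(h)$ be the probability that $i$ assigns to $\theta=G$ when the public history is $h$ and none of $i$'s experiments was successful; let $\sigma(R\mid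 h)$ be the probability with which the player active at $h$ plays $R$ when the public history is $h$ and none of his experiments was successful. Let $\phi(p)=\frac{p(1-\lambda)}{p(1-\lambda)+1-p}$. The SE is reasonable if for every public history $h$ and every $a\in\{R,S\}$, $p^i(hS)=\phi^{n_e(h)}(p_0)$ for the player $i$ active at $hS$, and $p^i(hSaR)=\phi^{n_e(hSa)}(p_0)$ for the player $i$ active at $hSaR$. The final belief of a player along an infinite play is the limit, if it exists, of the probability he assigns to $\theta=G$ at his successive private histories. Let $$p^*=\frac{c(1-\delta)}{c(1-\delta)+g(1-\delta(1-\lambda))},\qquad \widehat p=\frac{c(1-\delta)}{c(1-\delta)+g\bigl(1-\delta+\lambda\delta(1+\delta-\lambda\delta)\bigr)}.$$ Theorem. Let $(\sigma,\pi)$ be a reasonable SE. 1. If $p_0>p^*$, then with positive $\mathbf P_\sigma$-probability the final beliefs of both players exist and are at most $\widehat p$; if moreover $\phi^n(p_0)\neq\widehat p$ for all $n\ge 0$, then with positive $\mathbf P_\sigma$-probability they exist and are strictly less than $\widehat p$. 2. For every public history $h$ at which the active player $i$ has $p^i(h)<\widehat p$, one has $\sigma(R\mid h)=0$. -/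

import Mathlib

open Filter Topology MeasureTheory ProbabilityTheory

/-- Parameters of the experimentation game: prior `p0 = P(θ = G)`, success probability `lam` of the
good risky arm, prize `m`, cost `c` of the risky arm, discount factor `δ` between periods. -/
structure ExpGame where
  p0 : ℝ
  lam : ℝ
  m : ℝ
  c : ℝ
  δ : ℝ
  p0_pos : 0 < p0
  p0_lt_one : p0 < 1
  lam_pos : 0 < lam
  lam_lt_one : lam < 1
  c_pos : 0 < c
  δ_pos : 0 < δ
  δ_lt_one : δ < 1
  g_pos : 0 < lam * m - c

namespace ExpGame

/-- Type `θ` of the risky arm. -/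
inductive State
  | G
  | B
  deriving DecidableEq

/-- The safe arm `S` and the risky arm `R`. -/
inductive Arm
  | S
  | R
  deriving DecidableEq

/-- A move together with its outcome: the safe arm, or an experiment that succeeded (`true`) or
failed (`false`). -/
inductive Move
  | safe
  | risky (success : Bool)
  deriving DecidableEq

/-- The publicly observed part of a move. -/
def Move.arm : Move → Arm
  | .safe => .S
  | .risky _ => .R

/-- The move with arm `a` in which an experiment, if any, fails. -/
def Arm.failed : Arm → Move
  | .S => .safe
  | .R => .risky false

/-- Full histories: the state, and the past moves with all outcomes.
Throughout, histories are lists with the MOST RECENT entry FIRST; `a :: h` is "`h` followed by `a`". -/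
structure FullHist where
  state : State
  moves : List Move

instance : MeasurableSpace FullHist := ⊤

instance : DiscreteMeasurableSpace FullHist := ⟨fun _ => trivial⟩

/-- The two players; player `0` moves first. -/
abbrev Player := Fin 2

/-- The player who is active after `n` moves. -/
def active (n : ℕ) : Player := if Even n then 0 else 1

/-- Private histories of a player: an own move is observed with its outcome (`Sum.inl`), of a move
of the other player only the arm is observed (`Sum.inr`). The private histories of player `i` are
the lists of the form `view i h`. -/
abbrev PrivHist := List (Move ⊕ Arm)

/-- The private history of player `i` when the past moves are `h`. -/
def view (i : Player) : List Move → PrivHist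
  | [] => []
  | x :: h => (if active h.length = i then Sum.inl x else Sum.inr x.arm) :: view i h

/-- The private history of player `i` at which the public history is `h` and all past experiments
of `i` failed (the outcomes of the other player are not visible in it). -/
def failView (i : Player) (h : List Arm) : PrivHist := view i (h.map Arm.failed)

/-- A behavior strategy: a mixed move at each private history. -/
abbrev Strategy := PrivHist → PMF Arm

/-- A strategy for each player. -/
abbrev Profile := Player → Strategy

/-- A belief system: for each player and each private history, a distribution on full histories. -/
abbrev Beliefs := Player → PrivHist → PMF FullHist

/-- The distribution of a coin that shows `true` with probability `p`. -/
noncomputable def coin (p : ℝ) (h0 : 0 ≤ p) (h1 : p ≤ 1) : PMF Bool :=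
  PMF.ofFintype (fun b => if b then ENNReal.ofReal p else ENNReal.ofReal (1 - p)) (by
    simp [← ENNReal.ofReal_add h0 (sub_nonneg.2 h1)])

variable (Γ : ExpGame)

/-- `g = λ m - c`, the expected payoff of the risky arm in the good state. -/
def g : ℝ := Γ.lam * Γ.m - Γ.c

/-- Belief after a failed experiment, starting from belief `p`. -/
noncomputable def φ (p : ℝ) : ℝ := p * (1 - Γ.lam) / (p * (1 - Γ.lam) + 1 - p)

/-- The one-player cut-off `p*`. -/
noncomputable def pStar : ℝ :=
  Γ.c * (1 - Γ.δ) / (Γ.c * (1 - Γ.δ) + Γ.g * (1 - Γ.δ * (1 - Γ.lam)))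

/-- The encouragement cut-off. -/
noncomputable def pHat : ℝ :=
  Γ.c * (1 - Γ.δ) /
    (Γ.c * (1 - Γ.δ) + Γ.g * (1 - Γ.δ + Γ.lam * Γ.δ * (1 + Γ.δ - Γ.lam * Γ.δ)))

/-- Distribution of the move (with outcome) when arm `a` is chosen in state `θ`. -/
noncomputable def outcome : State → Arm → PMF Move
  | _, .S => PMF.pure .safe
  | .B, .R => PMF.pure (.risky false)
  | .G, .R => (coin Γ.lam Γ.lam_pos.le Γ.lam_lt_one.le).map .risky

/-- Distribution of the full history one move after `x`, when players use `σ`. -/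
noncomputable def step (σ : Profile) (x : FullHist) : PMF FullHist :=
  (σ (active x.moves.length) (view (active x.moves.length) x.moves)).bind fun a =>
    (Γ.outcome x.state a).map fun y => ⟨x.state, y :: x.moves⟩

/-- Distribution of the full history `n` moves later, if the current one has distribution `μ`. -/
noncomputable def evolve (σ : Profile) (μ : PMF FullHist) : ℕ → PMF FullHist
  | 0 => μ
  | n + 1 => (evolve σ μ n).bind (Γ.step σ)

/-- Distribution of the initial full history: only the state is drawn. -/
noncomputable def init : PMF FullHist :=
  (coin Γ.p0 Γ.p0_pos.le Γ.p0_lt_one.le).map fun b => ⟨if b then .G else .B, []⟩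

/-- The one-move transition kernel on full histories. -/
noncomputable def stepKernel (σ : Profile) : Kernel FullHist FullHist :=
  ⟨fun x => (Γ.step σ x).toMeasure, Measurable.of_discrete⟩

instance (σ : Profile) : IsMarkovKernel (Γ.stepKernel σ) :=
  ⟨fun x => inferInstanceAs (IsProbabilityMeasure (Γ.step σ x).toMeasure)⟩

/-- The law `P_σ` of the infinite play; the `n`-th coordinate is the full history after `n` moves. -/
noncomputable def playLaw (σ : Profile) : Measure (ℕ → FullHist) :=
  Kernel.trajMeasure (X := fun _ => FullHist) Γ.init.toMeasure fun n =>
    (Γ.stepKernel σ).comap (fun z : Finset.Iic n → FullHist => z ⟨n, by simp⟩)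
      (measurable_pi_apply _)

/-- Bayesian posterior probability of the full history `y` for player `i` at private history `v`,
when players use `τ`. -/
noncomputable def posterior (τ : Profile) (i : Player) (v : PrivHist) (y : FullHist) : ENNReal :=
  ((Γ.evolve τ Γ.init v.length).toMeasure[|{x | view i x.moves = v}]) {y}

/-- Every arm is chosen with positive probability at every private history. -/
def CompletelyMixed (τ : Profile) : Prop := ∀ i v a, τ i v a ≠ 0

/-- Consistency of beliefs with a profile: the pair is a (pointwise) limit of completely mixed
profiles and of the beliefs they induce by Bayes' rule. -/
def Consistent (σ : Profile) (π : Beliefs) : Prop :=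
  ∃ τ : ℕ → Profile, (∀ n, CompletelyMixed (τ n)) ∧
    (∀ i v a, Tendsto (fun n => τ n i v a) atTop (𝓝 (σ i v a))) ∧
    ∀ (i : Player) (h : List Move) (y : FullHist),
      Tendsto (fun n => Γ.posterior (τ n) i (view i h) y) atTop (𝓝 (π i (view i h) y))

/-- Realized payoff of a move to the player who makes it. -/
def payoff : Move → ℝ
  | .safe => 0
  | .risky s => (if s then Γ.m else 0) - Γ.c

/-- Realized payoff of the most recent move. -/
def lastPayoff (x : FullHist) : ℝ :=
  match x.moves with
  | [] => 0
  | y :: _ => Γ.payoff y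

/-- Normalized expected discounted continuation payoff of the player who is active at the current
full history, when the latter has distribution `μ` and players use `σ` from now on. That player
makes the moves number `1, 3, 5, …` from now on, one in each period. -/
noncomputable def contPayoff (σ : Profile) (μ : PMF FullHist) : ℝ :=
  (1 - Γ.δ) * ∑' k : ℕ, Γ.δ ^ k * ∫ x, Γ.lastPayoff x ∂(Γ.evolve σ μ (2 * k + 1)).toMeasure

/-- Sequential rationality: at each private history where he is active, the strategy of a player is
a best reply given his beliefs. -/
def SequentiallyRational (σ : Profile) (π : Beliefs) : Prop :=
  ∀ (i : Player) (h : List Move), active h.length = i → ∀ τ : Strategy,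
    Γ.contPayoff (Function.update σ i τ) (π i (view i h)) ≤ Γ.contPayoff σ (π i (view i h))

/-- Sequential equilibrium. -/
def IsSequentialEquilibrium (σ : Profile) (π : Beliefs) : Prop :=
  Γ.SequentiallyRational σ π ∧ Γ.Consistent σ π

/-- First-order belief (probability of the good state) of player `i` at private history `v`. -/
noncomputable def belief (π : Beliefs) (i : Player) (v : PrivHist) : ℝ :=
  ((π i v).toMeasure {x | x.state = State.G}).toReal

/-- `p^i(h)`: first-order belief of player `i` when the public history is `h` and `i` was not
successful. -/
noncomputable def pubBelief (π : Beliefs) (i : Player) (h : List Arm) : ℝ :=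
  belief π i (failView i h)

/-- Number of experiments along a public history. -/
def numExp (h : List Arm) : ℕ := h.count Arm.R

/-- Reasonable beliefs. A choice of `S` by the other player reveals that his past experiments
failed, and if he then chooses `R` in the next period, this choice is uninformative. -/
def Reasonable (π : Beliefs) : Prop :=
  ∀ h : List Arm,
    pubBelief π (active (Arm.S :: h).length) (Arm.S :: h) = Γ.φ^[numExp h] Γ.p0 ∧
    ∀ a : Arm, pubBelief π (active (Arm.R :: a :: Arm.S :: h).length) (Arm.R :: a :: Arm.S :: h) =
      Γ.φ^[numExp (a :: Arm.S :: h)] Γ.p0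

/-- `ℓ` is the final belief of player `i` along the infinite play `ω`. -/
def IsFinalBelief (π : Beliefs) (i : Player) (ω : ℕ → FullHist) (ℓ : ℝ) : Prop :=
  Tendsto (fun n => belief π i (view i (ω n).moves)) atTop (𝓝 ℓ)

end ExpGame

/-! ### Expectations under probability mass functions -/

namespace PMF

/-! A player who has succeeded knows that θ = G and experiments for ever
(`riskProb_eq_one_of_succ`). The belief of an unsuccessful player therefore has three parts: a mass
b on the bad state, where all experiments failed; a mass `odds n * b` on the good state with n
failed experiments and no success, the ratio being independent of the strategies and so valid off
the path too; and the rest X, on the good state with a success of the other player. The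
encouragement cut-off is the solution o of o · g · `den` = (1 - δ)c. Here g · `den` is the
good-state payoff of the plan "experiment once; after a failure, let the other player experiment in
reply and wait one round to see from his conduct whether he succeeded".

Statement 2. After an `S` of the other player, reasonable beliefs have X = 0. When the odds are
below the cut-off, backward induction on the number of experiments shows that an unsuccessful player
then answers with `S` (`riskProb_after_safe_eq_zero`): if experimentation stops after every `S` at
lower odds, the only benefit of an experiment is the plan above, and repeating it gains nothing
(`excess_nonpos`). At a general private history, compare experimenting with waiting. Waiting costs
nothing and reveals a success of the other player, hence is worth at least X · δ · g
(`le_contPayoff_of_waiting`), while an experiment is worth at most b(o g `den` - (1 - δ)c) + X g.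
Below the cut-off the first exceeds the second.

Statement 1. It suffices to find a public history that is reached in the bad state, at which the
common belief is at most the cut-off and after which unsuccessful players choose `S` for ever
(`exists_final_history`). Along this continuation two choices of `S` rule out past successes, so
beliefs settle at the common belief (`finalBelief_pos`). If some reached history has a common belief
below the cut-off, then `S` must be chosen at some later time, since perpetual experimentation would
drive private beliefs below the cut-off, against statement 2; after that `S` nobody unsuccessful
experiments. Otherwise the number of experiments on reached histories is bounded, and
experimentation stops at the maximum. The maximum is positive because p0 > p* makes a single
experiment profitable (`not_forall_safe`), so some such history ends with an experiment. If the odds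
there were above the cut-off, its author could go on experimenting after the other player's `S`:
this looks like a past success, so the other player is convinced and experiments too
(`riskProb_of_signal`). Probing in this way until the odds fall below the cut-off, and then waiting
for the reaction, is profitable (`odds_le_of_forall_safe`), a contradiction. -/

theorem toReal_apply_le_one {α : Type*} (p : PMF α) (a : α) : (p a).toReal ≤ 1 :=
  ENNReal.toReal_le_of_le_ofReal zero_le_one (by simpa using p.coe_le_one a)

theorem hasSum_toReal {α : Type*} (p : PMF α) : HasSum (fun a => (p a).toReal) 1 := by
  have h : Summable fun a => (p a).toReal := ENNReal.summable_toReal p.tsum_coe_ne_top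
  have h2 : ∑' a, (p a).toReal = 1 := by
    rw [← ENNReal.tsum_toReal_eq (fun a => p.apply_ne_top a), p.tsum_coe]; rfl
  exact h2 ▸ h.hasSum

/-- Boundedness of `f` makes the double family absolutely summable, so the order of summation may be
exchanged. -/
theorem tsum_bind_mul {α β : Type*} (p : PMF α) (q : α → PMF β) (f : β → ℝ) {C : ℝ}
    (hf : ∀ b, |f b| ≤ C) :
    ∑' b, (p.bind q b).toReal * f b = ∑' a, (p a).toReal * ∑' b, (q a b).toReal * f b := by
  have h1 : ∀ b, (p.bind q b).toReal = ∑' a, (p a).toReal * (q a b).toReal := by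
    intro b
    rw [bind_apply, ENNReal.tsum_toReal_eq]
    · simp [ENNReal.toReal_mul]
    · exact fun a => ENNReal.mul_ne_top (p.apply_ne_top a) ((q a).apply_ne_top b)
  have hs0 : Summable fun z : α × β => (p z.1).toReal * (q z.1 z.2).toReal := by
    have h0 : (0 : α × β → ℝ) ≤ fun z => (p z.1).toReal * (q z.1 z.2).toReal := fun z =>
      mul_nonneg ENNReal.toReal_nonneg ENNReal.toReal_nonneg
    have h2 : ∀ a, HasSum (fun b => (p a).toReal * (q a b).toReal) (p a).toReal := fun a => by
      simpa only [mul_one] using (q a).hasSum_toReal.mul_left (p a).toReal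
    refine (summable_prod_of_nonneg h0).2 ⟨fun a => (h2 a).summable, ?_⟩
    have h3 : (fun a => ∑' b, (p a).toReal * (q a b).toReal) = fun a => (p a).toReal :=
      funext fun a => (h2 a).tsum_eq
    exact h3 ▸ p.hasSum_toReal.summable
  have hs : Summable fun z : α × β => (p z.1).toReal * (q z.1 z.2).toReal * f z.2 := by
    refine Summable.of_norm_bounded (hs0.mul_right C) fun z => ?_
    have h0 : 0 ≤ (p z.1).toReal * (q z.1 z.2).toReal :=
      mul_nonneg ENNReal.toReal_nonneg ENNReal.toReal_nonneg
    rw [norm_mul, Real.norm_of_nonneg h0]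
    exact mul_le_mul_of_nonneg_left (hf _) h0
  calc ∑' b, (p.bind q b).toReal * f b
      = ∑' b, ∑' a, (p a).toReal * (q a b).toReal * f b := by simp only [h1, tsum_mul_right]
    _ = ∑' a, ∑' b, (p a).toReal * (q a b).toReal * f b := hs.tsum_comm
    _ = _ := by simp only [← tsum_mul_left, mul_assoc]

theorem tsum_pure_mul {α : Type*} (a : α) (f : α → ℝ) :
    ∑' b, ((pure a : PMF α) b).toReal * f b = f a := by
  rw [tsum_eq_single a]
  · simp
  · intro b hb; simp [hb]

theorem integrable_of_bound {α : Type*} [MeasurableSpace α] [DiscreteMeasurableSpace α]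
    (p : PMF α) {f : α → ℝ} {C : ℝ} (hf : ∀ b, |f b| ≤ C) : Integrable f p.toMeasure :=
  Integrable.of_bound (Measurable.of_discrete).aestronglyMeasurable C (ae_of_all _ hf)

theorem integral_bind_of_bound {α β : Type*} [MeasurableSpace α] [DiscreteMeasurableSpace α]
    [MeasurableSpace β] [DiscreteMeasurableSpace β]
    (p : PMF α) (q : α → PMF β) {f : β → ℝ} {C : ℝ} (hf : ∀ b, |f b| ≤ C) :
    ∫ b, f b ∂(p.bind q).toMeasure = ∫ a, ∫ b, f b ∂(q a).toMeasure ∂p.toMeasure := by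
  have hb : ∀ a, |∫ b, f b ∂(q a).toMeasure| ≤ C := fun a => by
    simpa using norm_integral_le_of_norm_le_const (μ := (q a).toMeasure) (f := f) (ae_of_all _ hf)
  rw [integral_eq_tsum _ _ (integrable_of_bound _ hf),
    integral_eq_tsum _ _ (integrable_of_bound _ hb)]
  simp only [smul_eq_mul]
  rw [tsum_bind_mul p q f hf]
  refine tsum_congr fun a => ?_
  rw [integral_eq_tsum _ _ (integrable_of_bound _ hf)]
  rfl

theorem ae_of_forall_ne_zero {α : Type*} [MeasurableSpace α] [DiscreteMeasurableSpace α]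
    (p : PMF α) {P : α → Prop} (h : ∀ a, p a ≠ 0 → P a) : ∀ᵐ a ∂p.toMeasure, P a := by
  rw [ae_iff, toMeasure_apply_eq_zero_iff _ (MeasurableSet.of_discrete), Set.disjoint_left]
  exact fun a ha hna => hna (h a ha)

/-- An integral against `p` is bounded by its values at two points and a bound elsewhere on the
support. -/
theorem integral_le_of_two_points {α : Type*} [MeasurableSpace α] [DiscreteMeasurableSpace α]
    (p : PMF α) {f : α → ℝ} {C : ℝ} (hf : ∀ a, |f a| ≤ C) {a b : α} (hab : a ≠ b) {k : ℝ}
    (hk : ∀ x, p x ≠ 0 → x ≠ a → x ≠ b → f x ≤ k) :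
    ∫ x, f x ∂p.toMeasure ≤ (p a).toReal * f a + (p b).toReal * f b
      + (1 - (p a).toReal - (p b).toReal) * k := by
  classical
  have h1 : ∀ᵐ x ∂p.toMeasure, f x ≤ k + (({a} : Set α).indicator (fun _ => f a - k) x
      + ({b} : Set α).indicator (fun _ => f b - k) x) := by
    refine p.ae_of_forall_ne_zero fun x hx => ?_
    by_cases hxa : x = a
    · subst hxa; simp [hab]
    by_cases hxb : x = b
    · subst hxb; simp [hxa]
    simp [hxa, hxb, hk x hx hxa hxb]
  have hi : ∀ (c : α) (r : ℝ),
      Integrable (({c} : Set α).indicator (fun _ => r)) p.toMeasure := fun c r =>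
    (integrable_const r).indicator (MeasurableSet.of_discrete)
  refine (integral_mono_ae (integrable_of_bound p hf)
    ((integrable_const k).add ((hi a _).add (hi b _))) h1).trans_eq ?_
  have hv : ∀ (c : α) (r : ℝ), ∫ x, ({c} : Set α).indicator (fun _ => r) x ∂p.toMeasure
      = (p c).toReal * r := fun c r => by
    rw [integral_indicator_const _ (MeasurableSet.of_discrete), measureReal_def,
      toMeasure_apply_singleton _ _ (MeasurableSet.of_discrete)]; rfl
  rw [integral_add' (integrable_const k) ((hi a _).add (hi b _)), integral_add' (hi a _) (hi b _),
    hv, hv]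
  simp
  ring

theorem le_integral_of_two_points {α : Type*} [MeasurableSpace α] [DiscreteMeasurableSpace α]
    (p : PMF α) {f : α → ℝ} {C : ℝ} (hf : ∀ a, |f a| ≤ C) {a b : α} (hab : a ≠ b) {k : ℝ}
    (hk : ∀ x, p x ≠ 0 → x ≠ a → x ≠ b → k ≤ f x) :
    (p a).toReal * f a + (p b).toReal * f b + (1 - (p a).toReal - (p b).toReal) * k
      ≤ ∫ x, f x ∂p.toMeasure := by
  have h := p.integral_le_of_two_points (f := fun x => - f x) (C := C) (by simpa using hf) hab
    (k := -k) (fun x h1 h2 h3 => neg_le_neg (hk x h1 h2 h3))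
  rw [integral_neg] at h
  linarith

end PMF

namespace ExpGame

/-! ### Views -/

theorem length_view (i : Player) (m : List Move) : (view i m).length = m.length := by
  induction m with
  | nil => rfl
  | cons x m ih => simp [view, ih]

theorem view_cons_own {i : Player} {m : List Move} (h : active m.length = i) (x : Move) :
    view i (x :: m) = Sum.inl x :: view i m := by simp [view, h]

theorem view_cons_other {i : Player} {m : List Move} (h : active m.length ≠ i) (x : Move) :
    view i (x :: m) = Sum.inr x.arm :: view i m := by simp [view, h]

theorem view_cons_congr {i : Player} {m m' : List Move} (h : view i m = view i m') (x : Move) :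
    view i (x :: m) = view i (x :: m') := by
  have hl : m.length = m'.length := by simpa [length_view] using congrArg List.length h
  rw [view, view, hl, h]

/-- Arms are public: every entry of a view, own or not, determines the arm. -/
theorem map_arm_eq_of_view_eq {i : Player} {m m' : List Move} (h : view i m = view i m') :
    m.map Move.arm = m'.map Move.arm := by
  induction m generalizing m' with
  | nil => cases m' with
    | nil => rfl
    | cons y m' => simp [view] at h
  | cons x m ih => cases m' with
    | nil => simp [view] at h
    | cons y m' =>
      simp only [view, List.cons.injEq] at h
      have hl : m.length = m'.length := by
        have := congrArg List.length h.2; simpa [length_view] using this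
      rw [hl] at h
      simp only [List.map_cons, List.cons.injEq]
      refine ⟨?_, ih h.2⟩
      by_cases ha : active m'.length = i
      · simp only [ha, if_true, Sum.inl.injEq] at h; rw [h.1]
      · simpa only [ha, if_false, Sum.inr.injEq] using h.1

@[simp] theorem arm_failed (a : Arm) : a.failed.arm = a := by cases a <;> rfl

@[simp] theorem map_arm_map_failed (h : List Arm) : (h.map Arm.failed).map Move.arm = h := by
  induction h with
  | nil => rfl
  | cons a h ih => simp [ih]

theorem failed_arm_of_ne {x : Move} (hx : x ≠ .risky true) : x.arm.failed = x := by
  rcases x with _ | _ | _ <;> first | rfl | exact absurd rfl hx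

theorem eq_map_failed {m : List Move} (hm : Move.risky true ∉ m) :
    m = (m.map Move.arm).map Arm.failed := by
  induction m with
  | nil => rfl
  | cons x m ih =>
    simp only [List.mem_cons, not_or] at hm
    simp only [List.map_cons, List.cons.injEq]
    exact ⟨(failed_arm_of_ne (Ne.symm hm.1)).symm, ih hm.2⟩

theorem risky_true_not_mem_map_failed (h : List Arm) : Move.risky true ∉ h.map Arm.failed := by
  simp only [List.mem_map, not_exists, not_and]
  rintro (_ | _) _ <;> simp [Arm.failed]

/-- Player `i` had a successful experiment in `m`. -/
def Succ (i : Player) (m : List Move) : Prop := Sum.inl (Move.risky true) ∈ view i m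

theorem Succ.cons {i : Player} {m : List Move} (h : Succ i m) (x : Move) : Succ i (x :: m) :=
  List.mem_cons_of_mem _ h

theorem mem_of_succ {i : Player} {m : List Move} (h : Succ i m) : Move.risky true ∈ m := by
  induction m with
  | nil => simp [Succ, view] at h
  | cons x m ih =>
    rw [Succ, view, List.mem_cons] at h
    rcases h with h | h
    · split_ifs at h
      simp at h; simp [h]
    · exact List.mem_cons_of_mem _ (ih h)

theorem exists_succ_of_mem {m : List Move} (h : Move.risky true ∈ m) : ∃ i, Succ i m := by
  induction m with
  | nil => simp at h
  | cons x m ih =>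
    rcases List.mem_cons.1 h with h | h
    · exact ⟨active m.length, by simp [Succ, view, ← h]⟩
    · obtain ⟨i, hi⟩ := ih h
      exact ⟨i, hi.cons x⟩

theorem not_succ_failed (i : Player) (h : List Arm) : ¬ Succ i (h.map Arm.failed) :=
  fun hs => risky_true_not_mem_map_failed h (mem_of_succ hs)

/-- A full history that looks to `i` like a history without success contains a success only if it
is a success of the other player. -/
theorem eq_map_failed_or_succ {i : Player} {m : List Move} {h : List Arm}
    (hv : view i m = failView i h) : m = h.map Arm.failed ∨ ∃ j, j ≠ i ∧ Succ j m := by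
  by_cases hm : Move.risky true ∈ m
  · obtain ⟨j, hj⟩ := exists_succ_of_mem hm
    refine Or.inr ⟨j, ?_, hj⟩
    rintro rfl
    rw [Succ, hv] at hj
    exact not_succ_failed _ h hj
  · left
    have := map_arm_eq_of_view_eq hv
    rw [map_arm_map_failed] at this
    rw [eq_map_failed hm, this]

theorem active_succ (n : ℕ) : active (n + 1) ≠ active n := by
  unfold active
  by_cases h : Even n
  · have : ¬ Even (n + 1) := by simpa [Nat.even_add_one] using h
    simp [h, this]
  · have : Even (n + 1) := by simpa [Nat.even_add_one] using h
    simp [h, this]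

@[simp] theorem active_add_two (n : ℕ) : active (n + 1 + 1) = active n := by
  unfold active; simp [Nat.even_add_one]

theorem eq_active_of_ne {n : ℕ} {i : Player} (h : i ≠ active n) : i = active (n + 1) := by
  have := active_succ n
  revert h this
  generalize active n = a
  generalize active (n + 1) = b
  revert i a b
  decide

variable (Γ : ExpGame)

/-! ### One-step expectations and values -/

/-- Probability that the active player experiments after the moves `m`. -/
noncomputable def riskProb (σ : Profile) (m : List Move) : ℝ :=
  (σ (active m.length) (view (active m.length) m) Arm.R).toReal

theorem riskProb_nonneg (σ : Profile) (m : List Move) : 0 ≤ riskProb σ m := ENNReal.toReal_nonneg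

theorem riskProb_le_one (σ : Profile) (m : List Move) : riskProb σ m ≤ 1 :=
  PMF.toReal_apply_le_one _ _

instance : Fintype Arm := ⟨{.S, .R}, fun a => by cases a <;> simp⟩

theorem sum_arm {M : Type*} [AddCommMonoid M] (f : Arm → M) : ∑ a, f a = f .S + f .R := by
  have : (Finset.univ : Finset Arm) = {.S, .R} := rfl
  rw [this, Finset.sum_pair (by simp)]

theorem toReal_safe (p : PMF Arm) : (p .S).toReal = 1 - (p .R).toReal := by
  have := p.hasSum_toReal.tsum_eq
  rw [tsum_fintype, sum_arm] at this
  linarith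

/-- Expectation of a function of the outcome of an experiment in a given state. -/
def expVal : State → (Move → ℝ) → ℝ
  | .G, f => Γ.lam * f (.risky true) + (1 - Γ.lam) * f (.risky false)
  | .B, f => f (.risky false)

/-- Expectation of a function of the next full history. -/
noncomputable def next (σ : Profile) (f : FullHist → ℝ) (x : FullHist) : ℝ :=
  (1 - riskProb σ x.moves) * f ⟨x.state, .safe :: x.moves⟩
    + riskProb σ x.moves * Γ.expVal x.state fun y => f ⟨x.state, y :: x.moves⟩

theorem tsum_coin_mul (p : ℝ) (h0 h1) (f : Bool → ℝ) :
    ∑' b, (coin p h0 h1 b).toReal * f b = p * f true + (1 - p) * f false := by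
  rw [tsum_fintype, Fintype.sum_bool]
  simp [coin, PMF.ofFintype_apply, ENNReal.toReal_ofReal, h0, h1]

theorem expVal_bound {θ : State} {f : Move → ℝ} {C : ℝ} (hf : ∀ s, |f (.risky s)| ≤ C) :
    |Γ.expVal θ f| ≤ C := by
  have h1 := abs_le.1 (hf true)
  have h2 := abs_le.1 (hf false)
  have := Γ.lam_pos
  have := Γ.lam_lt_one
  cases θ
  · rw [expVal, abs_le]; constructor <;> nlinarith
  · exact hf false

theorem expVal_le {θ : State} {f : Move → ℝ} {C : ℝ} (hf : ∀ s, f (.risky s) ≤ C) :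
    Γ.expVal θ f ≤ C := by
  have h1 := hf true
  have h2 := hf false
  have := Γ.lam_pos
  have := Γ.lam_lt_one
  cases θ
  · rw [expVal]; nlinarith
  · exact hf false

theorem le_expVal {θ : State} {f : Move → ℝ} {C : ℝ} (hf : ∀ s, C ≤ f (.risky s)) :
    C ≤ Γ.expVal θ f := by
  have h1 := hf true
  have h2 := hf false
  have := Γ.lam_pos
  have := Γ.lam_lt_one
  cases θ
  · rw [expVal]; nlinarith
  · exact hf false

theorem next_le {σ : Profile} {f : FullHist → ℝ} {x : FullHist} {C : ℝ}
    (hf : ∀ y, f ⟨x.state, y :: x.moves⟩ ≤ C) : Γ.next σ f x ≤ C := by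
  have h1 := hf .safe
  have h2 := Γ.expVal_le (θ := x.state) (f := fun y => f ⟨x.state, y :: x.moves⟩)
    fun s => hf (.risky s)
  have := riskProb_nonneg σ x.moves
  have := riskProb_le_one σ x.moves
  unfold next; nlinarith

theorem le_next {σ : Profile} {f : FullHist → ℝ} {x : FullHist} {C : ℝ}
    (hf : ∀ y, C ≤ f ⟨x.state, y :: x.moves⟩) : C ≤ Γ.next σ f x := by
  have h1 := hf .safe
  have h2 := Γ.le_expVal (θ := x.state) (f := fun y => f ⟨x.state, y :: x.moves⟩)
    fun s => hf (.risky s)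
  have := riskProb_nonneg σ x.moves
  have := riskProb_le_one σ x.moves
  unfold next; nlinarith

theorem next_bound {σ : Profile} {f : FullHist → ℝ} {C : ℝ} (hf : ∀ x, |f x| ≤ C) (x : FullHist) :
    |Γ.next σ f x| ≤ C :=
  abs_le.2 ⟨Γ.le_next fun _ => (abs_le.1 (hf _)).1, Γ.next_le fun _ => (abs_le.1 (hf _)).2⟩

theorem iterate_next_bound {σ : Profile} {f : FullHist → ℝ} {C : ℝ} (hf : ∀ x, |f x| ≤ C) (n : ℕ)
    (x : FullHist) : |(Γ.next σ)^[n] f x| ≤ C := by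
  induction n generalizing f with
  | zero => exact hf x
  | succ n ih => exact ih (Γ.next_bound hf)

theorem integral_step {σ : Profile} {f : FullHist → ℝ} {C : ℝ} (hf : ∀ x, |f x| ≤ C)
    (x : FullHist) : ∫ y, f y ∂(Γ.step σ x).toMeasure = Γ.next σ f x := by
  rw [PMF.integral_eq_tsum _ _ (PMF.integrable_of_bound _ hf)]
  simp only [smul_eq_mul, step]
  rw [PMF.tsum_bind_mul _ _ _ hf, tsum_fintype, sum_arm, toReal_safe]
  have hm : ∀ a, ∑' b, ((Γ.outcome x.state a).map (fun y => (⟨x.state, y :: x.moves⟩ : FullHist))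
      b).toReal * f b = ∑' y, (Γ.outcome x.state a y).toReal * f ⟨x.state, y :: x.moves⟩ := by
    intro a
    rw [← PMF.bind_pure_comp, PMF.tsum_bind_mul _ _ _ hf]
    simp only [Function.comp, PMF.tsum_pure_mul]
  rw [hm, hm, next, riskProb]
  congr 2
  · cases x.state <;> simp only [outcome, PMF.tsum_pure_mul]
  · cases x.state
    · simp only [outcome, expVal]
      rw [← PMF.bind_pure_comp, PMF.tsum_bind_mul _ _ _ (fun b => hf _)]
      simp only [Function.comp, PMF.tsum_pure_mul, tsum_coin_mul]
    · simp only [outcome, PMF.tsum_pure_mul, expVal]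

/-- Pushing the distribution forward is dual to pulling the function back by `next`. Payoffs thus
become functions on full histories, and beliefs enter only as the measure of integration. -/
theorem integral_evolve {σ : Profile} {f : FullHist → ℝ} {C : ℝ} (hf : ∀ x, |f x| ≤ C)
    (μ : PMF FullHist) (n : ℕ) :
    ∫ y, f y ∂(Γ.evolve σ μ n).toMeasure = ∫ x, (Γ.next σ)^[n] f x ∂μ.toMeasure := by
  induction n generalizing f with
  | zero => rfl
  | succ n ih =>
    rw [evolve, PMF.integral_bind_of_bound _ _ hf]
    simp only [Γ.integral_step hf]
    rw [ih (Γ.next_bound hf)]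
    rfl

/-- A bound on realized payoffs. -/
noncomputable def payBound : ℝ := |Γ.m| + Γ.c

theorem lastPayoff_bound (x : FullHist) : |Γ.lastPayoff x| ≤ Γ.payBound := by
  have hc := Γ.c_pos
  have hm := abs_nonneg Γ.m
  obtain ⟨θ, _ | ⟨_ | _ | _, m⟩⟩ := x <;>
    simp only [lastPayoff, payoff, payBound, Bool.false_eq_true, if_true, if_false, zero_sub,
      abs_neg, abs_zero]
  · positivity
  · positivity
  · rw [abs_of_pos hc]; linarith
  · exact (abs_sub _ _).trans (by rw [abs_of_pos hc])

/-! ### Values at full histories and the Bellman equation -/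

/-- Continuation payoff of the active player at the full history `x`. -/
noncomputable def val (σ : Profile) (x : FullHist) : ℝ :=
  (1 - Γ.δ) * ∑' k : ℕ, Γ.δ ^ k * (Γ.next σ)^[2 * k + 1] Γ.lastPayoff x

theorem summable_val (σ : Profile) (x : FullHist) :
    Summable fun k : ℕ => Γ.δ ^ k * (Γ.next σ)^[2 * k + 1] Γ.lastPayoff x := by
  refine Summable.of_norm_bounded
    ((summable_geometric_of_lt_one Γ.δ_pos.le Γ.δ_lt_one).mul_right Γ.payBound) fun k => ?_
  rw [norm_mul, Real.norm_of_nonneg (pow_nonneg Γ.δ_pos.le _)]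
  exact mul_le_mul_of_nonneg_left (Γ.iterate_next_bound Γ.lastPayoff_bound _ _)
    (pow_nonneg Γ.δ_pos.le _)

theorem val_bound (σ : Profile) (x : FullHist) : |Γ.val σ x| ≤ Γ.payBound := by
  have hδ := Γ.δ_lt_one
  have h1 : |∑' k : ℕ, Γ.δ ^ k * (Γ.next σ)^[2 * k + 1] Γ.lastPayoff x|
      ≤ (1 - Γ.δ)⁻¹ * Γ.payBound := by
    refine tsum_of_norm_bounded (E := ℝ)
      ((hasSum_geometric_of_lt_one Γ.δ_pos.le Γ.δ_lt_one).mul_right Γ.payBound) fun k => ?_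
    rw [norm_mul, Real.norm_of_nonneg (pow_nonneg Γ.δ_pos.le _)]
    exact mul_le_mul_of_nonneg_left (Γ.iterate_next_bound Γ.lastPayoff_bound _ _)
      (pow_nonneg Γ.δ_pos.le _)
  rw [val, abs_mul, abs_of_pos (sub_pos.2 hδ)]
  calc _ ≤ (1 - Γ.δ) * ((1 - Γ.δ)⁻¹ * Γ.payBound) :=
        mul_le_mul_of_nonneg_left h1 (sub_pos.2 hδ).le
    _ = _ := by rw [← mul_assoc, mul_inv_cancel₀ (sub_pos.2 hδ).ne', one_mul]

/-- Geometric discounting of bounded payoffs allows the sum over periods and the integral to be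
exchanged; hence the payoff is linear in the belief. -/
theorem contPayoff_eq_integral (σ : Profile) (μ : PMF FullHist) :
    Γ.contPayoff σ μ = ∫ x, Γ.val σ x ∂μ.toMeasure := by
  rw [contPayoff]
  simp only [val, integral_const_mul, Γ.integral_evolve Γ.lastPayoff_bound]
  congr 1
  simp only [← integral_const_mul]
  have hb : ∀ k : ℕ, ∀ x, |Γ.δ ^ k * (Γ.next σ)^[2 * k + 1] Γ.lastPayoff x|
      ≤ Γ.δ ^ k * Γ.payBound := fun k x => by
    rw [abs_mul, abs_of_nonneg (pow_nonneg Γ.δ_pos.le _)]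
    exact mul_le_mul_of_nonneg_left (Γ.iterate_next_bound Γ.lastPayoff_bound _ _)
      (pow_nonneg Γ.δ_pos.le _)
  rw [integral_tsum_of_summable_integral_norm]
  · exact fun k => PMF.integrable_of_bound μ (hb k)
  · refine Summable.of_nonneg_of_le (fun k => integral_nonneg fun x => norm_nonneg _) (fun k => ?_)
      ((summable_geometric_of_lt_one Γ.δ_pos.le Γ.δ_lt_one).mul_right Γ.payBound)
    have := integral_mono (μ := μ.toMeasure) (PMF.integrable_of_bound μ (hb k)).norm
      (integrable_const (Γ.δ ^ k * Γ.payBound)) (fun x => hb k x)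
    simpa using this

/-- Expected flow payoff of an experiment. -/
def gain : State → ℝ
  | .G => Γ.g
  | .B => -Γ.c

theorem next_lastPayoff (σ : Profile) (x : FullHist) :
    Γ.next σ Γ.lastPayoff x = riskProb σ x.moves * Γ.gain x.state := by
  obtain ⟨θ, m⟩ := x
  cases θ <;> simp [next, lastPayoff, payoff, expVal, gain, g]
  left; ring

theorem next_tsum {σ : Profile} {F : ℕ → FullHist → ℝ} (hF : ∀ x, Summable fun k => F k x)
    (x : FullHist) : Γ.next σ (fun y => ∑' k, F k y) x = ∑' k, Γ.next σ (F k) x := by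
  obtain ⟨θ, m⟩ := x
  cases θ
  · have h1 := ((hF ⟨.G, .safe :: m⟩).hasSum.mul_left (1 - riskProb σ m)).add
      ((((hF ⟨.G, .risky true :: m⟩).hasSum.mul_left Γ.lam).add
      ((hF ⟨.G, .risky false :: m⟩).hasSum.mul_left (1 - Γ.lam))).mul_left (riskProb σ m))
    exact h1.tsum_eq.symm
  · have h1 := ((hF ⟨.B, .safe :: m⟩).hasSum.mul_left (1 - riskProb σ m)).add
      ((hF ⟨.B, .risky false :: m⟩).hasSum.mul_left (riskProb σ m))
    exact h1.tsum_eq.symm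

theorem next_const_mul (σ : Profile) (r : ℝ) (f : FullHist → ℝ) (x : FullHist) :
    Γ.next σ (fun y => r * f y) x = r * Γ.next σ f x := by
  obtain ⟨θ, m⟩ := x
  cases θ <;> simp only [next, expVal] <;> ring

/-- Bellman equation, by splitting off the term k = 0. There are two applications of `next` because
the same player moves again after two moves, at the cost of one factor δ. -/
theorem val_eq (σ : Profile) (x : FullHist) :
    Γ.val σ x = (1 - Γ.δ) * (riskProb σ x.moves * Γ.gain x.state)
      + Γ.δ * Γ.next σ (Γ.next σ (Γ.val σ)) x := by
  have hs := Γ.summable_val σ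
  have h1 : ∀ y, Γ.next σ (Γ.val σ) y
      = ∑' k : ℕ, (1 - Γ.δ) * (Γ.δ ^ k * (Γ.next σ)^[2 * k + 2] Γ.lastPayoff y) := by
    intro y
    have : Γ.val σ = fun y => ∑' k : ℕ,
        (1 - Γ.δ) * (Γ.δ ^ k * (Γ.next σ)^[2 * k + 1] Γ.lastPayoff y) := by
      funext y; rw [val, tsum_mul_left]
    rw [this, Γ.next_tsum (fun x => (hs x).mul_left _)]
    refine tsum_congr fun k => ?_
    rw [Γ.next_const_mul, Γ.next_const_mul, ← Function.iterate_succ_apply' (Γ.next σ)]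
  have hs2 : ∀ y, Summable fun k : ℕ =>
      (1 - Γ.δ) * (Γ.δ ^ k * (Γ.next σ)^[2 * k + 2] Γ.lastPayoff y) := by
    intro y
    refine Summable.mul_left _ (Summable.of_norm_bounded
      ((summable_geometric_of_lt_one Γ.δ_pos.le Γ.δ_lt_one).mul_right Γ.payBound) fun k => ?_)
    rw [norm_mul, Real.norm_of_nonneg (pow_nonneg Γ.δ_pos.le _)]
    exact mul_le_mul_of_nonneg_left (Γ.iterate_next_bound Γ.lastPayoff_bound _ _)
      (pow_nonneg Γ.δ_pos.le _)
  have h2 : Γ.next σ (Γ.next σ (Γ.val σ)) x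
      = ∑' k : ℕ, (1 - Γ.δ) * (Γ.δ ^ k * (Γ.next σ)^[2 * k + 3] Γ.lastPayoff x) := by
    rw [show Γ.next σ (Γ.val σ) = _ from funext h1, Γ.next_tsum hs2]
    refine tsum_congr fun k => ?_
    rw [Γ.next_const_mul, Γ.next_const_mul, ← Function.iterate_succ_apply' (Γ.next σ)]
  rw [h2, val, (hs x).tsum_eq_zero_add, ← Γ.next_lastPayoff σ x, mul_add, ← tsum_mul_left,
    ← tsum_mul_left]
  congr 1
  · simp
  · refine tsum_congr fun k => ?_
    rw [show 2 * (k + 1) + 1 = 2 * k + 3 by ring]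
    ring

/-- Continuation payoff of the active player at `x` if he now chooses arm `a`. -/
noncomputable def qval (σ : Profile) (x : FullHist) : Arm → ℝ
  | .S => Γ.δ * Γ.next σ (Γ.val σ) ⟨x.state, .safe :: x.moves⟩
  | .R => (1 - Γ.δ) * Γ.gain x.state
      + Γ.δ * Γ.expVal x.state fun y => Γ.next σ (Γ.val σ) ⟨x.state, y :: x.moves⟩

theorem val_eq_qval (σ : Profile) (x : FullHist) :
    Γ.val σ x = (1 - riskProb σ x.moves) * Γ.qval σ x .S + riskProb σ x.moves * Γ.qval σ x .R := by
  rw [val_eq, qval, qval, next]; ring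

end ExpGame

namespace ExpGame

variable (Γ : ExpGame)

/-! ### Bounds on values -/

/-- A bounded function that is bounded by `δ D` whenever it is bounded by `D` is nonpositive. -/
theorem nonpos_of_contraction {ι : Type*} {P : ι → Prop} {f : ι → ℝ} {M : ℝ}
    (hM : ∀ x, P x → f x ≤ M)
    (h : ∀ D, 0 ≤ D → (∀ x, P x → f x ≤ D) → ∀ x, P x → f x ≤ Γ.δ * D) :
    ∀ x, P x → f x ≤ 0 := by
  have hn : ∀ n : ℕ, ∀ x, P x → f x ≤ Γ.δ ^ n * max M 0 := by
    intro n
    induction n with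
    | zero => intro x hx; simpa using Or.inl (hM x hx)
    | succ n ih =>
      intro x hx
      rw [pow_succ', mul_assoc]
      exact h _ (mul_nonneg (pow_nonneg Γ.δ_pos.le _) (le_max_right _ _)) ih x hx
  intro x hx
  have ht : Tendsto (fun n : ℕ => Γ.δ ^ n * max M 0) atTop (𝓝 (0 * max M 0)) :=
    (tendsto_pow_atTop_nhds_zero_of_lt_one Γ.δ_pos.le Γ.δ_lt_one).mul_const _
  rw [zero_mul] at ht
  exact ge_of_tendsto' ht fun n => hn n x hx

theorem g_pos' : 0 < Γ.g := Γ.g_pos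

/-- The largest continuation payoff in each state. -/
def topVal : State → ℝ
  | .G => Γ.g
  | .B => 0

/-- The flow payoff never exceeds the top value of the state, so by the Bellman equation any excess
over the top value shrinks by δ each period. -/
theorem val_le_topVal (σ : Profile) (x : FullHist) : Γ.val σ x ≤ Γ.topVal x.state := by
  have := Γ.nonpos_of_contraction (P := fun _ : FullHist => True)
    (f := fun x => Γ.val σ x - Γ.topVal x.state) (M := Γ.payBound) (fun x _ => ?_)
    (fun D hD h y _ => ?_) x trivial
  · linarith
  · have h1 := (abs_le.1 (Γ.val_bound σ x)).2
    have h2 : 0 ≤ Γ.topVal x.state := by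
      cases x.state
      · exact Γ.g_pos'.le
      · exact le_rfl
    linarith
  · have h1 : Γ.next σ (Γ.next σ (Γ.val σ)) y ≤ Γ.topVal y.state + D :=
      Γ.next_le fun z => Γ.next_le fun z' => by
        have := h ⟨y.state, z' :: z :: y.moves⟩ trivial
        simp only at this ⊢
        linarith
    have h2 : riskProb σ y.moves * Γ.gain y.state ≤ Γ.topVal y.state := by
      have h3 := riskProb_nonneg σ y.moves
      have h4 := riskProb_le_one σ y.moves
      have h5 := Γ.g_pos'
      have h6 := Γ.c_pos
      cases y.state <;> simp only [gain, topVal] <;> nlinarith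
    have h3 := Γ.δ_lt_one
    have h4 := Γ.δ_pos
    rw [val_eq]
    nlinarith

theorem val_good_le (σ : Profile) (m : List Move) : Γ.val σ ⟨.G, m⟩ ≤ Γ.g :=
  Γ.val_le_topVal σ ⟨.G, m⟩

theorem val_bad_le (σ : Profile) (m : List Move) : Γ.val σ ⟨.B, m⟩ ≤ 0 :=
  Γ.val_le_topVal σ ⟨.B, m⟩

theorem next_val_good_le (σ : Profile) (m : List Move) : Γ.next σ (Γ.val σ) ⟨.G, m⟩ ≤ Γ.g :=
  Γ.next_le fun _ => Γ.val_good_le _ _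

theorem next_val_bad_le (σ : Profile) (m : List Move) : Γ.next σ (Γ.val σ) ⟨.B, m⟩ ≤ 0 :=
  Γ.next_le fun _ => Γ.val_bad_le _ _

theorem qval_risky_good_le (σ : Profile) (m : List Move) : Γ.qval σ ⟨.G, m⟩ .R ≤ Γ.g := by
  have h : Γ.expVal .G (fun y => Γ.next σ (Γ.val σ) ⟨.G, y :: m⟩) ≤ Γ.g :=
    Γ.expVal_le fun s => Γ.next_val_good_le _ _
  have := Γ.δ_pos
  simp only [qval, gain]; nlinarith

theorem qval_risky_bad_le (σ : Profile) (m : List Move) :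
    Γ.qval σ ⟨.B, m⟩ .R ≤ -((1 - Γ.δ) * Γ.c) := by
  have h : Γ.expVal .B (fun y => Γ.next σ (Γ.val σ) ⟨.B, y :: m⟩) ≤ 0 :=
    Γ.expVal_le fun s => Γ.next_val_bad_le _ _
  have := Γ.δ_pos
  simp only [qval, gain]; nlinarith

theorem qval_safe_good_le (σ : Profile) (m : List Move) : Γ.qval σ ⟨.G, m⟩ .S ≤ Γ.δ * Γ.g :=
  mul_le_mul_of_nonneg_left (Γ.next_val_good_le _ _) Γ.δ_pos.le

theorem qval_bound (σ : Profile) (x : FullHist) (a : Arm) :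
    |Γ.qval σ x a| ≤ |Γ.gain x.state| + Γ.payBound := by
  have hδ := Γ.δ_pos
  have hδ' := Γ.δ_lt_one
  have hg := abs_nonneg (Γ.gain x.state)
  have hn := Γ.next_bound (σ := σ) (Γ.val_bound σ)
  have hp : 0 ≤ Γ.payBound := (abs_nonneg _).trans (Γ.val_bound σ x)
  cases a
  · rw [qval, abs_mul, abs_of_pos hδ]
    have := hn ⟨x.state, .safe :: x.moves⟩
    nlinarith [abs_nonneg (Γ.next σ (Γ.val σ) ⟨x.state, .safe :: x.moves⟩)]
  · have h1 := Γ.expVal_bound (θ := x.state)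
      (f := fun y => Γ.next σ (Γ.val σ) ⟨x.state, y :: x.moves⟩) (fun s => hn _)
    rw [qval]
    refine (abs_add_le _ _).trans ?_
    rw [abs_mul, abs_mul, abs_of_pos hδ, abs_of_pos (sub_pos.2 hδ')]
    nlinarith

theorem qval_bound' (σ : Profile) (x : FullHist) (a : Arm) :
    |Γ.qval σ x a| ≤ |Γ.g| + |Γ.c| + Γ.payBound := by
  refine (Γ.qval_bound σ x a).trans ?_
  have := abs_nonneg Γ.g
  have := abs_nonneg Γ.c
  cases x.state <;> simp only [gain, abs_neg] <;> linarith

/-- A player who experiments forever in the good state gets `g`. -/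
theorem val_good_eq_of_risky {σ : Profile} {P : List Move → Prop}
    (hP : ∀ m, P m → ∀ y z, P (z :: y :: m)) (hr : ∀ m, P m → riskProb σ m = 1)
    {m : List Move} (hm : P m) : Γ.val σ ⟨.G, m⟩ = Γ.g := by
  refine le_antisymm (Γ.val_good_le _ _) ?_
  have := Γ.nonpos_of_contraction (P := P)
    (f := fun m => Γ.g - Γ.val σ ⟨.G, m⟩) (M := Γ.g + Γ.payBound) (fun m _ => ?_)
    (fun D hD h y hy => ?_) m hm
  · linarith
  · have h1 := (abs_le.1 (Γ.val_bound σ ⟨.G, m⟩)).1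
    linarith
  · have h1 : Γ.g - D ≤ Γ.next σ (Γ.next σ (Γ.val σ)) ⟨.G, y⟩ :=
      Γ.le_next fun z => Γ.le_next fun z' => by
        have := h (z' :: z :: y) (hP y hy z z')
        simp only at this ⊢
        linarith
    have h4 := Γ.δ_pos
    rw [val_eq, hr y hy]
    simp only [gain]
    nlinarith

/-- A player who never experiments again gets `0`. -/
theorem val_eq_zero_of_safe {σ : Profile} {P : List Move → Prop} (θ : State)
    (hS : ∀ m, P m → riskProb σ m = 0 ∧ P (.safe :: .safe :: m))
    (hR : ∀ m, P m → riskProb σ (.safe :: m) ≠ 0 → ∀ s, P (.risky s :: .safe :: m))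
    {m : List Move} (hm : P m) : Γ.val σ ⟨θ, m⟩ = 0 := by
  have := Γ.nonpos_of_contraction (P := P)
    (f := fun m => |Γ.val σ ⟨θ, m⟩|) (M := Γ.payBound) (fun m _ => Γ.val_bound _ _)
    (fun D hD h y hy => ?_) m hm
  · exact abs_eq_zero.1 (le_antisymm this (abs_nonneg _))
  · have h1 : |Γ.next σ (Γ.val σ) ⟨θ, .safe :: y⟩| ≤ D := by
      have hs := h _ (hS y hy).2
      by_cases h0 : riskProb σ (.safe :: y) = 0
      · simpa [next, h0] using hs
      · have he := Γ.expVal_bound (θ := θ) (f := fun z => Γ.val σ ⟨θ, z :: .safe :: y⟩)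
          fun s => h _ (hR y hy h0 s)
        rw [next]
        have h3 := riskProb_nonneg σ (.safe :: y)
        have h4 := riskProb_le_one σ (.safe :: y)
        refine (abs_add_le _ _).trans ?_
        rw [abs_mul, abs_mul, abs_of_nonneg h3, abs_of_nonneg (sub_nonneg.2 h4)]
        simp only at hs he ⊢
        nlinarith
    rw [val_eq_qval, (hS y hy).1, qval]
    simp only [sub_zero, one_mul, zero_mul, add_zero, abs_mul, abs_of_pos Γ.δ_pos]
    exact mul_le_mul_of_nonneg_left h1 Γ.δ_pos.le

/-! ### Locality and deviations -/

theorem iterate_next_congr {σ σ' : Profile} {L : ℕ}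
    (h : ∀ m : List Move, L ≤ m.length → riskProb σ m = riskProb σ' m) (n : ℕ)
    {f f' : FullHist → ℝ} (hf : ∀ x, L ≤ x.moves.length → f x = f' x) :
    ∀ x, L ≤ x.moves.length → (Γ.next σ)^[n] f x = (Γ.next σ')^[n] f' x := by
  induction n generalizing f f' with
  | zero => exact hf
  | succ n ih =>
    refine ih fun x hx => ?_
    have hl : ∀ y : Move, f ⟨x.state, y :: x.moves⟩ = f' ⟨x.state, y :: x.moves⟩ := fun y =>
      hf _ (by simp; omega)
    simp only [next, h _ hx, hl]

theorem val_congr {σ σ' : Profile} {L : ℕ}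
    (h : ∀ m : List Move, L ≤ m.length → riskProb σ m = riskProb σ' m) {x : FullHist}
    (hx : L ≤ x.moves.length) : Γ.val σ x = Γ.val σ' x := by
  unfold val
  congr 1
  exact tsum_congr fun k => by rw [Γ.iterate_next_congr h _ (fun _ _ => rfl) x hx]

/-- Once the present arm is fixed, only behavior at strictly longer histories matters; a deviation
confined to the present move therefore has the payoff `qval σ`. -/
theorem qval_congr {σ σ' : Profile} {x : FullHist}
    (h : ∀ m : List Move, x.moves.length < m.length → riskProb σ m = riskProb σ' m) (a : Arm) :
    Γ.qval σ x a = Γ.qval σ' x a := by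
  have h1 : ∀ y : Move, Γ.next σ (Γ.val σ) ⟨x.state, y :: x.moves⟩
      = Γ.next σ' (Γ.val σ') ⟨x.state, y :: x.moves⟩ := fun y =>
    Γ.iterate_next_congr h 1 (fun z hz => Γ.val_congr h hz) _ (by simp)
  cases a <;> simp only [qval, h1]

theorem riskProb_update_self {σ : Profile} {i : Player} {m : List Move} (h : active m.length = i)
    (τ : Strategy) : riskProb (Function.update σ i τ) m = (τ (view i m) .R).toReal := by
  subst h; simp [riskProb]

theorem riskProb_update_other {σ : Profile} {i : Player} {m : List Move} (h : active m.length ≠ i)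
    (τ : Strategy) : riskProb (Function.update σ i τ) m = riskProb σ m := by
  simp [riskProb, Function.update_of_ne h]

theorem riskProb_congr {σ : Profile} {m m' : List Move}
    (h : view (active m.length) m = view (active m.length) m') : riskProb σ m = riskProb σ m' := by
  have hl : m.length = m'.length := by
    simpa [length_view] using congrArg List.length h
  rw [riskProb, riskProb, h, hl]

/-- One-shot deviation: the strategy is changed at the single private history in question. Lengths
grow along play, so the change is never met again. -/
theorem integral_qval_le {σ : Profile} {π : Beliefs} (hSR : Γ.SequentiallyRational σ π)
    {i : Player} {h : List Move} (hi : active h.length = i)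
    (hsupp : ∀ y, π i (view i h) y ≠ 0 → view i y.moves = view i h) (a : Arm) :
    ∫ x, Γ.qval σ x a ∂(π i (view i h)).toMeasure ≤ Γ.contPayoff σ (π i (view i h)) := by
  classical
  set τ : Strategy := Function.update (σ i) (view i h) (PMF.pure a) with hτ
  refine le_trans (le_of_eq ?_) (hSR i h hi τ)
  rw [contPayoff_eq_integral]
  refine integral_congr_ae (PMF.ae_of_forall_ne_zero _ fun x hx => ?_)
  have hv := hsupp x hx
  have hl : x.moves.length = h.length := by
    simpa [length_view] using congrArg List.length hv
  have hq : ∀ b, Γ.qval σ x b = Γ.qval (Function.update σ i τ) x b := by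
    refine Γ.qval_congr fun m hm => ?_
    by_cases hmi : active m.length = i
    · rw [riskProb_update_self hmi, hτ, Function.update_of_ne]
      · rw [riskProb, hmi]
      · intro he
        have := congrArg List.length he
        rw [length_view, length_view] at this
        omega
    · rw [riskProb_update_other hmi]
  simp only
  rw [val_eq_qval, riskProb_update_self (hl ▸ hi), hv, hτ, Function.update_self, ← hτ, hq a]
  cases a <;> simp

/-- The full histories that carry the belief share one view, so the mixing probability is constant
and can be taken out of the integral. -/
theorem contPayoff_eq_qval {σ : Profile} {π : Beliefs} {i : Player} {h : List Move}
    (hi : active h.length = i)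
    (hsupp : ∀ y, π i (view i h) y ≠ 0 → view i y.moves = view i h) :
    Γ.contPayoff σ (π i (view i h)) =
      (1 - riskProb σ h) * ∫ x, Γ.qval σ x .S ∂(π i (view i h)).toMeasure
        + riskProb σ h * ∫ x, Γ.qval σ x .R ∂(π i (view i h)).toMeasure := by
  rw [contPayoff_eq_integral, ← integral_const_mul, ← integral_const_mul, ← integral_add]
  · refine integral_congr_ae (PMF.ae_of_forall_ne_zero _ fun x hx => ?_)
    have hv := hsupp x hx
    have hl : x.moves.length = h.length := by
      simpa [length_view] using congrArg List.length hv
    have : riskProb σ x.moves = riskProb σ h := riskProb_congr (by rw [hl, hi, hv])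
    simp only
    rw [val_eq_qval, this]
  all_goals
    exact (PMF.integrable_of_bound _ fun x => Γ.qval_bound' σ x _).const_mul _

/-- An arm used with positive probability must itself be optimal. -/
theorem contPayoff_le_of_riskProb_ne_zero {σ : Profile} {π : Beliefs}
    (hSR : Γ.SequentiallyRational σ π) {i : Player} {h : List Move} (hi : active h.length = i)
    (hsupp : ∀ y, π i (view i h) y ≠ 0 → view i y.moves = view i h) (hr : riskProb σ h ≠ 0) :
    Γ.contPayoff σ (π i (view i h)) ≤ ∫ x, Γ.qval σ x .R ∂(π i (view i h)).toMeasure := by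
  have h1 := Γ.contPayoff_eq_qval (σ := σ) hi hsupp
  have h2 := Γ.integral_qval_le hSR hi hsupp .S
  have h3 := riskProb_le_one σ h
  have h4 : 0 < riskProb σ h := lt_of_le_of_ne (riskProb_nonneg _ _) (Ne.symm hr)
  by_contra! hlt
  nlinarith

theorem contPayoff_le_of_riskProb_ne_one {σ : Profile} {π : Beliefs}
    (hSR : Γ.SequentiallyRational σ π) {i : Player} {h : List Move} (hi : active h.length = i)
    (hsupp : ∀ y, π i (view i h) y ≠ 0 → view i y.moves = view i h) (hr : riskProb σ h ≠ 1) :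
    Γ.contPayoff σ (π i (view i h)) ≤ ∫ x, Γ.qval σ x .S ∂(π i (view i h)).toMeasure := by
  have h1 := Γ.contPayoff_eq_qval (σ := σ) hi hsupp
  have h2 := Γ.integral_qval_le hSR hi hsupp .R
  have h3 := riskProb_nonneg σ h
  have h4 : riskProb σ h < 1 := lt_of_le_of_ne (riskProb_le_one _ _) hr
  by_contra! hlt
  nlinarith

/-- A player who is sure that the state is good experiments. -/
theorem riskProb_eq_one_of_sure {σ : Profile} {π : Beliefs}
    (hSR : Γ.SequentiallyRational σ π) {i : Player} {h : List Move} (hi : active h.length = i)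
    (hsupp : ∀ y, π i (view i h) y ≠ 0 → view i y.moves = view i h)
    (hG : ∀ y, π i (view i h) y ≠ 0 → y.state = .G) : riskProb σ h = 1 := by
  by_contra hr
  have h1 := Γ.contPayoff_le_of_riskProb_ne_one hSR hi hsupp hr
  have h2 := hSR i h hi (fun _ => PMF.pure .R)
  have h3 : Γ.contPayoff (Function.update σ i fun _ => PMF.pure .R) (π i (view i h)) = Γ.g := by
    rw [contPayoff_eq_integral]
    have : ∫ x, Γ.val (Function.update σ i fun _ => PMF.pure .R) x ∂(π i (view i h)).toMeasure
        = ∫ _, Γ.g ∂(π i (view i h)).toMeasure := by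
      refine integral_congr_ae (PMF.ae_of_forall_ne_zero _ fun x hx => ?_)
      have hl : x.moves.length = h.length := by
        simpa [length_view] using congrArg List.length (hsupp x hx)
      have hG := hG x hx
      obtain ⟨θ, m⟩ := x
      subst hG
      exact Γ.val_good_eq_of_risky (P := fun m => active m.length = i) (fun m hm y z => by simpa)
        (fun m hm => by rw [riskProb_update_self hm]; simp) (hl ▸ hi)
    rw [this]; simp
  have h4 : ∫ x, Γ.qval σ x .S ∂(π i (view i h)).toMeasure ≤ Γ.δ * Γ.g := by
    have : ∫ x, Γ.qval σ x .S ∂(π i (view i h)).toMeasure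
        ≤ ∫ _, Γ.δ * Γ.g ∂(π i (view i h)).toMeasure := by
      refine integral_mono_ae (PMF.integrable_of_bound _ fun x => Γ.qval_bound' σ x _)
        (integrable_const _) (PMF.ae_of_forall_ne_zero _ fun x hx => ?_)
      have hG := hG x hx
      obtain ⟨θ, m⟩ := x
      subst hG
      exact Γ.qval_safe_good_le _ _
    simpa using this
  have := Γ.g_pos'
  have := Γ.δ_lt_one
  nlinarith

/-! ### Weights of full histories and beliefs -/

/-- Prior probability of a state. -/
def prior : State → ℝ
  | .G => Γ.p0
  | .B => 1 - Γ.p0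

/-- Probability of the outcome recorded in a move, given its arm. -/
def outProb : State → Move → ℝ
  | _, .safe => 1
  | .G, .risky true => Γ.lam
  | .G, .risky false => 1 - Γ.lam
  | .B, .risky true => 0
  | .B, .risky false => 1

/-- Probability of a full history under a profile. -/
noncomputable def wt (τ : Profile) (θ : State) : List Move → ℝ
  | [] => Γ.prior θ
  | x :: m => wt τ θ m * (τ (active m.length) (view (active m.length) m) x.arm).toReal
      * Γ.outProb θ x

theorem prior_pos (θ : State) : 0 < Γ.prior θ := by
  cases θ
  · exact Γ.p0_pos
  · exact sub_pos.2 Γ.p0_lt_one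

theorem outProb_nonneg (θ : State) (x : Move) : 0 ≤ Γ.outProb θ x := by
  have := Γ.lam_pos
  have := Γ.lam_lt_one
  rcases θ with _ | _ <;> rcases x with _ | _ | _ <;> simp only [outProb] <;> linarith

theorem wt_nonneg (τ : Profile) (θ : State) (m : List Move) : 0 ≤ Γ.wt τ θ m := by
  induction m with
  | nil => exact (Γ.prior_pos θ).le
  | cons x m ih =>
    exact mul_nonneg (mul_nonneg ih ENNReal.toReal_nonneg) (Γ.outProb_nonneg θ x)

theorem outcome_apply (θ : State) (a : Arm) (y : Move) :
    Γ.outcome θ a y = if y.arm = a then ENNReal.ofReal (Γ.outProb θ y) else 0 := by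
  rcases θ with _ | _ <;> rcases a with _ | _ <;> rcases y with _ | _ | _ <;>
    simp [outcome, Move.arm, outProb, PMF.map_apply, tsum_fintype, coin, PMF.ofFintype_apply]

theorem step_apply_cons (σ : Profile) (x : FullHist) (θ : State) (y : Move) (m : List Move)
    [Decidable (x = ⟨θ, m⟩)] :
    Γ.step σ x ⟨θ, y :: m⟩ = if x = ⟨θ, m⟩ then
      σ (active m.length) (view (active m.length) m) y.arm * ENNReal.ofReal (Γ.outProb θ y)
      else 0 := by
  classical
  have hm : ∀ a, ((Γ.outcome x.state a).map (fun z => (⟨x.state, z :: x.moves⟩ : FullHist)))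
      ⟨θ, y :: m⟩ = if x = ⟨θ, m⟩ then Γ.outcome θ a y else 0 := by
    intro a
    rw [PMF.map_apply]
    split_ifs with hx
    · subst hx
      rw [tsum_eq_single y]
      · simp
      · intro z hz; simp [Ne.symm hz]
    · rw [ENNReal.tsum_eq_zero]
      intro z
      rw [if_neg]
      rintro he
      simp only [FullHist.mk.injEq, List.cons.injEq] at he
      exact hx (by rcases x with ⟨a, b⟩; simp_all)
  rw [step, PMF.bind_apply, tsum_fintype, sum_arm, hm, hm]
  split_ifs with hx
  · subst hx
    rw [outcome_apply, outcome_apply]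
    cases h : y.arm <;> simp
  · simp

theorem step_apply_nil (σ : Profile) (x : FullHist) (θ : State) : Γ.step σ x ⟨θ, []⟩ = 0 := by
  rw [step, PMF.bind_apply, ENNReal.tsum_eq_zero]
  intro a
  rw [PMF.map_apply, mul_eq_zero]
  right
  rw [ENNReal.tsum_eq_zero]
  intro z
  simp

theorem evolve_init_apply (τ : Profile) (n : ℕ) (θ : State) (m : List Move) :
    Γ.evolve τ Γ.init n ⟨θ, m⟩ = if m.length = n then ENNReal.ofReal (Γ.wt τ θ m) else 0 := by
  classical
  induction n generalizing m with
  | zero =>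
    rw [evolve, ExpGame.init, PMF.map_apply, tsum_fintype, Fintype.sum_bool]
    rcases m with _ | ⟨x, m⟩ <;> rcases θ with _ | _ <;>
      simp [wt, prior, coin, PMF.ofFintype_apply]
  | succ n ih =>
    rw [evolve, PMF.bind_apply]
    rcases m with _ | ⟨x, m⟩
    · simp [step_apply_nil]
    · simp only [step_apply_cons]
      rw [tsum_eq_single ⟨θ, m⟩]
      · rw [ih]
        simp only [List.length_cons, Nat.add_right_cancel_iff, if_true]
        split_ifs
        · rw [wt, ENNReal.ofReal_mul (mul_nonneg (Γ.wt_nonneg _ _ _) ENNReal.toReal_nonneg),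
            ENNReal.ofReal_mul (Γ.wt_nonneg _ _ _), ENNReal.ofReal_toReal (PMF.apply_ne_top _ _),
            mul_assoc]
        · simp
      · intro y hy; simp [hy]

/-- Probability that player `i` is at the private history `v`. -/
noncomputable def viewProb (τ : Profile) (i : Player) (v : PrivHist) : ENNReal :=
  (Γ.evolve τ Γ.init v.length).toMeasure {x | view i x.moves = v}

theorem posterior_eq (τ : Profile) (i : Player) (v : PrivHist) (y : FullHist)
    [Decidable (view i y.moves = v)] :
    Γ.posterior τ i v y = if view i y.moves = v then
      (Γ.viewProb τ i v)⁻¹ * ENNReal.ofReal (Γ.wt τ y.state y.moves) else 0 := by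
  rw [posterior, cond_apply (MeasurableSet.of_discrete)]
  split_ifs with h
  · have : {x : FullHist | view i x.moves = v} ∩ {y} = {y} := by
      ext z; simp only [Set.mem_inter_iff, Set.mem_ofPred_eq, Set.mem_singleton_iff]
      exact ⟨fun hz => hz.2, fun hz => ⟨hz ▸ h, hz⟩⟩
    rw [this, PMF.toMeasure_apply_singleton _ _ (MeasurableSet.of_discrete), viewProb]
    obtain ⟨θ, m⟩ := y
    rw [evolve_init_apply, if_pos (by rw [← h, length_view])]
  · have : {x : FullHist | view i x.moves = v} ∩ {y} = ∅ := by
      ext z; simp only [Set.mem_inter_iff, Set.mem_ofPred_eq, Set.mem_singleton_iff]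
      exact ⟨fun hz => h (hz.2 ▸ hz.1), fun hz => hz.elim⟩
    rw [this]; simp

theorem wt_le_viewProb (τ : Profile) (i : Player) (θ : State) (m : List Move) :
    ENNReal.ofReal (Γ.wt τ θ m) ≤ Γ.viewProb τ i (view i m) := by
  have h := Γ.evolve_init_apply τ m.length θ m
  rw [if_pos rfl] at h
  rw [← h, viewProb, length_view,
    ← PMF.toMeasure_apply_singleton _ _ (MeasurableSet.of_discrete)]
  exact measure_mono (by simp)

variable {Γ}

/-- A weight is a finite product, so pointwise convergence of the profiles is enough. -/
theorem tendsto_wt {τ : ℕ → Profile} {σ : Profile}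
    (h : ∀ i v a, Tendsto (fun n => τ n i v a) atTop (𝓝 (σ i v a))) (θ : State) (m : List Move) :
    Tendsto (fun n => Γ.wt (τ n) θ m) atTop (𝓝 (Γ.wt σ θ m)) := by
  induction m with
  | nil => exact tendsto_const_nhds
  | cons x m ih =>
    exact (ih.mul ((ENNReal.tendsto_toReal (PMF.apply_ne_top _ _)).comp (h _ _ _))).mul_const _

/-! ### Consequences of consistency -/

/-- Beliefs are concentrated on the full histories compatible with the private history. -/
theorem Consistent.view_eq {σ : Profile} {π : Beliefs} (hC : Γ.Consistent σ π) {i : Player}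
    {h : List Move} {y : FullHist} (hy : π i (view i h) y ≠ 0) : view i y.moves = view i h := by
  classical
  obtain ⟨τ, -, -, hb⟩ := hC
  by_contra hv
  refine hy (tendsto_nhds_unique (hb i h y) ?_)
  simp only [posterior_eq, hv, if_false]
  exact tendsto_const_nhds

/-- Bayes' rule on the equilibrium path, as an inequality. -/
theorem Consistent.mul_wt_le {σ : Profile} {π : Beliefs} (hC : Γ.Consistent σ π) {i : Player}
    {h : List Move} (y : FullHist) {θ : State} {m : List Move} (hm : view i m = view i h) :
    π i (view i h) y * ENNReal.ofReal (Γ.wt σ θ m)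
      ≤ ENNReal.ofReal (Γ.wt σ y.state y.moves) := by
  classical
  obtain ⟨τ, -, hτ, hb⟩ := hC
  have h1 : Tendsto (fun n => Γ.posterior (τ n) i (view i h) y * ENNReal.ofReal (Γ.wt (τ n) θ m))
      atTop (𝓝 (π i (view i h) y * ENNReal.ofReal (Γ.wt σ θ m))) :=
    ENNReal.Tendsto.mul (hb i h y) (Or.inr ENNReal.ofReal_ne_top)
      (ENNReal.tendsto_ofReal (tendsto_wt hτ θ m)) (Or.inr (PMF.apply_ne_top _ _))
  refine le_of_tendsto_of_tendsto' h1 (ENNReal.tendsto_ofReal (tendsto_wt hτ y.state y.moves))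
    fun n => ?_
  rw [posterior_eq]
  split_ifs
  · have h2 := Γ.wt_le_viewProb (τ n) i θ m
    rw [hm] at h2
    calc _ ≤ (Γ.viewProb (τ n) i (view i h))⁻¹ * ENNReal.ofReal (Γ.wt (τ n) y.state y.moves)
          * Γ.viewProb (τ n) i (view i h) := by gcongr
      _ = ((Γ.viewProb (τ n) i (view i h))⁻¹ * Γ.viewProb (τ n) i (view i h))
          * ENNReal.ofReal (Γ.wt (τ n) y.state y.moves) := by ring
      _ ≤ 1 * ENNReal.ofReal (Γ.wt (τ n) y.state y.moves) := by
          gcongr; exact ENNReal.inv_mul_le_one _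
      _ = _ := one_mul _
  · simp

/-- A full history whose weight vanishes gets probability zero, if the private history is
reached. -/
theorem Consistent.eq_zero {σ : Profile} {π : Beliefs} (hC : Γ.Consistent σ π) {i : Player}
    {h : List Move} {y : FullHist} (hy : Γ.wt σ y.state y.moves = 0) {θ : State} {m : List Move}
    (hm : view i m = view i h) (h0 : Γ.wt σ θ m ≠ 0) : π i (view i h) y = 0 := by
  have h1 := hC.mul_wt_le y (θ := θ) hm
  rw [hy, ENNReal.ofReal_zero, nonpos_iff_eq_zero, mul_eq_zero] at h1
  refine h1.resolve_right ?_
  rw [ENNReal.ofReal_eq_zero, not_le]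
  exact lt_of_le_of_ne (Γ.wt_nonneg _ _ _) (Ne.symm h0)

/-- The ratio of the beliefs in two full histories is the ratio of their weights, if the latter
does not depend on the profile. -/
theorem Consistent.apply_eq_mul {σ : Profile} {π : Beliefs} (hC : Γ.Consistent σ π) {i : Player}
    {h : List Move} {y z : FullHist} {r : ℝ} (hr : 0 ≤ r) (hv : view i y.moves = view i z.moves)
    (hw : ∀ τ, Γ.wt τ y.state y.moves = r * Γ.wt τ z.state z.moves) :
    π i (view i h) y = ENNReal.ofReal r * π i (view i h) z := by
  classical
  obtain ⟨τ, -, hτ, hb⟩ := hC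
  refine tendsto_nhds_unique (hb i h y) ?_
  have h1 := ENNReal.Tendsto.const_mul (a := ENNReal.ofReal r) (hb i h z)
    (Or.inr ENNReal.ofReal_ne_top)
  convert h1 using 2 with n
  rw [posterior_eq, posterior_eq, hv, hw, ENNReal.ofReal_mul hr]
  split_ifs
  · ring
  · simp

theorem wt_bad_eq_zero (τ : Profile) {m : List Move} (hm : Move.risky true ∈ m) :
    Γ.wt τ .B m = 0 := by
  induction m with
  | nil => simp at hm
  | cons x m ih =>
    rcases List.mem_cons.1 hm with h | h
    · rw [wt, ← h, outProb, mul_zero]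
    · rw [wt, ih h]; ring

/-- Success is impossible in the bad state under every profile, and the arms are public; this leaves
a single full history. -/
theorem Consistent.eq_map_failed {σ : Profile} {π : Beliefs} (hC : Γ.Consistent σ π) {i : Player}
    {h : List Arm} {y : FullHist} (hy : π i (failView i h) y ≠ 0) (hB : y.state = .B) :
    y = ⟨.B, h.map Arm.failed⟩ := by
  have hv := hC.view_eq hy
  have hm : Move.risky true ∉ y.moves := by
    intro hm
    -- The weight of `y` vanishes under every profile, so it is `0` times itself, and the ratio rule
    -- with r = 0 carries this to the belief.
    have := hC.apply_eq_mul (h := h.map Arm.failed) (y := y) (z := y) (i := i) le_rfl rfl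
      fun τ => by rw [hB, wt_bad_eq_zero τ hm]; ring
    rw [ENNReal.ofReal_zero, zero_mul] at this
    exact hy this
  have h2 := ExpGame.eq_map_failed hm
  rw [map_arm_eq_of_view_eq hv, map_arm_map_failed] at h2
  rcases y with ⟨θ, m⟩
  simp only at h2 hB
  rw [hB, h2]

theorem Consistent.state_eq_good {σ : Profile} {π : Beliefs} (hC : Γ.Consistent σ π) {i : Player}
    {m : List Move} (hs : Succ i m) {y : FullHist} (hy : π i (view i m) y ≠ 0) :
    y.state = .G := by
  by_contra hB
  replace hB : y.state = .B := by cases h : y.state <;> simp_all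
  have hv := hC.view_eq hy
  have hm : Move.risky true ∈ y.moves := mem_of_succ (i := i) (by rw [Succ, hv]; exact hs)
  have := hC.apply_eq_mul (h := m) (y := y) (z := y) (i := i) le_rfl rfl fun τ => by
    rw [hB, wt_bad_eq_zero τ hm]; ring
  rw [ENNReal.ofReal_zero, zero_mul] at this
  exact hy this

/-- A successful player experiments. -/
theorem riskProb_eq_one_of_succ {σ : Profile} {π : Beliefs} (hSE : Γ.IsSequentialEquilibrium σ π)
    {m : List Move} (hs : Succ (active m.length) m) : riskProb σ m = 1 :=
  Γ.riskProb_eq_one_of_sure hSE.1 rfl (fun _ => hSE.2.view_eq) fun _ => hSE.2.state_eq_good hs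

/-! ### Odds after failed experiments -/

variable (Γ)

/-- Odds of the good state after `n` failed experiments. -/
noncomputable def odds (n : ℕ) : ℝ := Γ.p0 * (1 - Γ.lam) ^ n / (1 - Γ.p0)

theorem odds_pos (n : ℕ) : 0 < Γ.odds n :=
  div_pos (mul_pos Γ.p0_pos (pow_pos (sub_pos.2 Γ.lam_lt_one) n)) (sub_pos.2 Γ.p0_lt_one)

theorem odds_succ (n : ℕ) : Γ.odds (n + 1) = (1 - Γ.lam) * Γ.odds n := by
  rw [odds, odds, pow_succ]; ring

/-- Players see the same views in both states, so the factors of the strategies cancel; each failed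
experiment leaves a likelihood ratio 1 - λ. -/
theorem wt_good_failed (τ : Profile) (h : List Arm) :
    Γ.wt τ .G (h.map Arm.failed) = Γ.odds (numExp h) * Γ.wt τ .B (h.map Arm.failed) := by
  induction h with
  | nil =>
    have := (sub_pos.2 Γ.p0_lt_one).ne'
    simp only [List.map_nil, wt, prior, numExp, List.count_nil, odds, pow_zero]
    field_simp
  | cons a h ih =>
    cases a
    · simp only [List.map_cons, Arm.failed, wt, ih, outProb, numExp]
      rw [List.count_cons_of_ne (by simp)]
      ring
    · simp only [List.map_cons, Arm.failed, wt, ih, outProb, numExp]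
      rw [List.count_cons_self, odds_succ]
      ring

/-- In terms of odds, φ is multiplication by 1 - λ. -/
theorem phi_iterate (n : ℕ) : Γ.φ^[n] Γ.p0 = Γ.odds n / (1 + Γ.odds n) := by
  induction n with
  | zero =>
    have h1 := (sub_pos.2 Γ.p0_lt_one).ne'
    simp only [Function.iterate_zero, id, odds, pow_zero, mul_one]
    field_simp
    ring
  | succ n ih =>
    rw [Function.iterate_succ_apply', ih, odds_succ, φ]
    have h := Γ.odds_pos n
    have hu := sub_pos.2 Γ.lam_lt_one
    have h1 : (1 + Γ.odds n) ≠ 0 := by positivity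
    have h2 : (1 + (1 - Γ.lam) * Γ.odds n) ≠ 0 := by positivity
    have h3 : Γ.odds n / (1 + Γ.odds n) * (1 - Γ.lam) + 1 - Γ.odds n / (1 + Γ.odds n)
        = (1 + (1 - Γ.lam) * Γ.odds n) / (1 + Γ.odds n) := by
      field_simp; ring
    rw [h3]
    field_simp

variable {Γ}

/-- The belief that the state is bad and, inevitably, all experiments failed. -/
theorem Consistent.pubBelief_eq {σ : Profile} {π : Beliefs} (hC : Γ.Consistent σ π) (i : Player)
    (h : List Arm) :
    pubBelief π i h = 1 - (π i (failView i h) ⟨.B, h.map Arm.failed⟩).toReal := by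
  set μ := π i (failView i h) with hμ
  have h1 : μ.toMeasure {x | x.state = .G}ᶜ = μ ⟨.B, h.map Arm.failed⟩ := by
    rw [← PMF.toMeasure_apply_singleton μ _ (MeasurableSet.of_discrete)]
    refine PMF.toMeasure_apply_eq_of_inter_support_eq μ (MeasurableSet.of_discrete)
      (MeasurableSet.of_discrete) ?_
    ext y
    simp only [Set.mem_inter_iff, Set.mem_compl_iff, Set.mem_ofPred_eq, PMF.mem_support_iff,
      Set.mem_singleton_iff]
    constructor
    · rintro ⟨hy, h0⟩
      have hB : y.state = .B := by cases h : y.state <;> simp_all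
      exact ⟨hC.eq_map_failed h0 hB, h0⟩
    · rintro ⟨rfl, h0⟩
      exact ⟨by simp, h0⟩
  rw [pubBelief, belief, ← hμ, ← h1, prob_compl_eq_one_sub (MeasurableSet.of_discrete),
    ENNReal.toReal_sub_of_le prob_le_one ENNReal.one_ne_top]
  simp

/-- Valid off the path as well, because the ratio of the two weights is the same for all profiles
approximating `σ`. -/
theorem Consistent.good_eq_odds_mul {σ : Profile} {π : Beliefs} (hC : Γ.Consistent σ π) (i : Player)
    (h : List Arm) :
    (π i (failView i h) ⟨.G, h.map Arm.failed⟩).toReal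
      = Γ.odds (numExp h) * (π i (failView i h) ⟨.B, h.map Arm.failed⟩).toReal := by
  have := hC.apply_eq_mul (h := h.map Arm.failed) (i := i) (y := ⟨.G, h.map Arm.failed⟩)
    (z := ⟨.B, h.map Arm.failed⟩) (Γ.odds_pos (numExp h)).le rfl fun τ => Γ.wt_good_failed τ h
  rw [failView, this, ENNReal.toReal_mul, ENNReal.toReal_ofReal (Γ.odds_pos _).le]

end ExpGame

namespace ExpGame

variable (Γ : ExpGame)

/-! ### The cut-off in terms of odds -/

/-- The factor of `g` in the encouragement cut-off. -/
noncomputable def den : ℝ := 1 - Γ.δ + Γ.lam * Γ.δ * (1 + Γ.δ - Γ.lam * Γ.δ)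

/-- Used to compare the gain (1 - δ)g from experimenting at once instead of waiting, when the other
player has succeeded, with g · `den`. -/
theorem one_sub_delta_le_den : 1 - Γ.δ ≤ Γ.den := by
  have h1 := Γ.lam_pos
  have h2 := Γ.lam_lt_one
  have h3 := Γ.δ_pos
  have : 0 ≤ Γ.lam * Γ.δ * (1 + Γ.δ - Γ.lam * Γ.δ) :=
    mul_nonneg (mul_nonneg h1.le h3.le) (by nlinarith)
  unfold den; linarith

theorem den_pos : 0 < Γ.den := lt_of_lt_of_le (sub_pos.2 Γ.δ_lt_one) Γ.one_sub_delta_le_den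

theorem pHat_eq : Γ.pHat = Γ.c * (1 - Γ.δ) / (Γ.c * (1 - Γ.δ) + Γ.g * Γ.den) := rfl

theorem pHat_den_pos : 0 < Γ.c * (1 - Γ.δ) + Γ.g * Γ.den :=
  add_pos (mul_pos Γ.c_pos (sub_pos.2 Γ.δ_lt_one)) (mul_pos Γ.g_pos' Γ.den_pos)

theorem lt_pHat_iff (p : ℝ) :
    p < Γ.pHat ↔ p * (Γ.g * Γ.den) < (1 - p) * ((1 - Γ.δ) * Γ.c) := by
  rw [pHat_eq, lt_div_iff₀ Γ.pHat_den_pos]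
  constructor <;> intro h <;> nlinarith

theorem pHat_lt_iff (p : ℝ) :
    Γ.pHat < p ↔ (1 - p) * ((1 - Γ.δ) * Γ.c) < p * (Γ.g * Γ.den) := by
  rw [pHat_eq, div_lt_iff₀ Γ.pHat_den_pos]
  constructor <;> intro h <;> nlinarith

theorem phi_lt_pHat_iff (n : ℕ) :
    Γ.φ^[n] Γ.p0 < Γ.pHat ↔ Γ.odds n * (Γ.g * Γ.den) < (1 - Γ.δ) * Γ.c := by
  have h := Γ.odds_pos n
  have h1 : 1 - Γ.odds n / (1 + Γ.odds n) = 1 / (1 + Γ.odds n) := by field_simp; ring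
  rw [lt_pHat_iff, phi_iterate, h1, div_mul_eq_mul_div, div_mul_eq_mul_div, one_mul,
    div_lt_div_iff_of_pos_right (by positivity)]

theorem pHat_lt_phi_iff (n : ℕ) :
    Γ.pHat < Γ.φ^[n] Γ.p0 ↔ (1 - Γ.δ) * Γ.c < Γ.odds n * (Γ.g * Γ.den) := by
  have h := Γ.odds_pos n
  have h1 : 1 - Γ.odds n / (1 + Γ.odds n) = 1 / (1 + Γ.odds n) := by field_simp; ring
  rw [pHat_lt_iff, phi_iterate, h1, div_mul_eq_mul_div, div_mul_eq_mul_div, one_mul,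
    div_lt_div_iff_of_pos_right (by positivity)]

theorem odds_antitone : Antitone Γ.odds := by
  refine antitone_nat_of_succ_le fun n => ?_
  rw [odds_succ]
  have := Γ.odds_pos n
  have := Γ.lam_pos
  nlinarith

theorem tendsto_odds : Tendsto Γ.odds atTop (𝓝 0) := by
  have h := (tendsto_pow_atTop_nhds_zero_of_lt_one (sub_pos.2 Γ.lam_lt_one).le
    (by linarith [Γ.lam_pos] : 1 - Γ.lam < 1)).const_mul (Γ.p0 / (1 - Γ.p0))
  rw [mul_zero] at h
  refine h.congr fun n => ?_
  rw [odds]; ring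

theorem exists_odds_mul_lt (r : ℝ) {s : ℝ} (hs : 0 < s) : ∃ N, Γ.odds N * r < s := by
  have h := Γ.tendsto_odds.mul_const r
  rw [zero_mul] at h
  exact (h.eventually (gt_mem_nhds hs)).exists

/-! ### Play after unsuccessful histories -/

variable {Γ}
variable {σ : Profile} {π : Beliefs}

theorem riskProb_failed (h : List Arm) : riskProb σ (h.map Arm.failed)
    = (σ (active h.length) (failView (active h.length) h) .R).toReal := by
  simp [riskProb, failView]

theorem view_risky_other {i : Player} {m : List Move} (h : active m.length ≠ i) (s s' : Bool) :
    view i (.risky s :: m) = view i (.risky s' :: m) := by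
  simp [view, h, Move.arm]

/-- The outcome of the move just made is hidden from the player who moves next. -/
theorem riskProb_risky (s s' : Bool) (m : List Move) :
    riskProb σ (.risky s :: m) = riskProb σ (.risky s' :: m) :=
  riskProb_congr (view_risky_other (by simpa using (active_succ m.length).symm) _ _)

theorem numExp_safe (h : List Arm) : numExp (.S :: h) = numExp h :=
  List.count_cons_of_ne (by simp)

theorem numExp_risky (h : List Arm) : numExp (.R :: h) = numExp h + 1 := List.count_cons_self

/-! ### Low odds: experiments do not pay -/

/-- If unsuccessful players stop experimenting once `S` has been chosen, values vanish. -/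
theorem val_safe_failed_eq_zero {h : List Arm}
    (hs : ∀ h', numExp h' = numExp h → riskProb σ ((Arm.S :: h').map Arm.failed) = 0) (θ : State) :
    Γ.val σ ⟨θ, (Arm.S :: h).map Arm.failed⟩ = 0 := by
  refine Γ.val_eq_zero_of_safe
    (P := fun m => ∃ h', numExp h' = numExp h ∧ m = (Arm.S :: h').map Arm.failed) θ ?_ ?_
    ⟨h, rfl, rfl⟩
  · rintro _ ⟨h', hn, rfl⟩
    exact ⟨hs h' hn, Arm.S :: Arm.S :: h', by simpa [numExp_safe] using hn, rfl⟩
  · rintro _ ⟨h', hn, rfl⟩ h0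
    exact absurd (hs (Arm.S :: h') (by simpa [numExp_safe] using hn)) h0

variable (Γ σ) in
/-- Excess of the continuation payoff of an unsuccessful player over what he gets by waiting, when
the other player has just made the last experiment of `R :: h` and no earlier success. -/
noncomputable def excess (h : List Arm) : ℝ :=
  Γ.val σ ⟨.B, (Arm.R :: h).map Arm.failed⟩
    + Γ.odds (numExp h + 1) * Γ.val σ ⟨.G, (Arm.R :: h).map Arm.failed⟩
    + Γ.lam * Γ.odds (numExp h) * Γ.val σ ⟨.G, .risky true :: h.map Arm.failed⟩
    - Γ.δ * (Γ.lam * Γ.odds (numExp h)) * Γ.g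

/-- If the reply to a failed experiment is `S`, play stops and nothing more is earned. If it is `R`,
the continuation is worth at most `D` more than waiting, and waiting yields δ g in the event, of
good-state probability (1 - λ)λ, that the own experiment failed and the reply succeeded. Together
with the flow (1 - δ)g and the value g after an own success, of probability λ, these terms make up g
· `den`. -/
theorem qval_bad_add_odds_mul_qval_good_le {h : List Arm}
    (hs : ∀ h', numExp h < numExp h' → riskProb σ ((Arm.S :: h').map Arm.failed) = 0)
    {D : ℝ} (hD : 0 ≤ D) (he : excess Γ σ (Arm.R :: h) ≤ D) :
    Γ.qval σ ⟨.B, h.map Arm.failed⟩ .R + Γ.odds (numExp h) * Γ.qval σ ⟨.G, h.map Arm.failed⟩ .R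
      ≤ Γ.odds (numExp h) * (Γ.g * Γ.den) - (1 - Γ.δ) * Γ.c + Γ.δ * D := by
  have hz : ∀ θ, Γ.val σ ⟨θ, (Arm.S :: Arm.R :: h).map Arm.failed⟩ = 0 := fun θ =>
    val_safe_failed_eq_zero (fun h' hn => hs h' (by rw [hn, numExp_risky]; omega)) θ
  set r := riskProb σ ((Arm.R :: h).map Arm.failed) with hr
  have hr0 : 0 ≤ r := riskProb_nonneg _ _
  have hr1 : r ≤ 1 := riskProb_le_one _ _
  have hB : Γ.qval σ ⟨.B, h.map Arm.failed⟩ .R = -((1 - Γ.δ) * Γ.c)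
      + Γ.δ * (r * Γ.val σ ⟨.B, (Arm.R :: Arm.R :: h).map Arm.failed⟩) := by
    have h1 : Γ.next σ (Γ.val σ) ⟨.B, (Arm.R :: h).map Arm.failed⟩
        = r * Γ.val σ ⟨.B, (Arm.R :: Arm.R :: h).map Arm.failed⟩ := by
      have h2 := hz .B
      simp only [List.map_cons, Arm.failed] at h2 hr ⊢
      simp only [next, expVal, h2, ← hr]
      ring
    simp only [List.map_cons, Arm.failed] at h1
    simp only [qval, gain, expVal, h1, List.map_cons, Arm.failed]
    ring
  have hG : Γ.qval σ ⟨.G, h.map Arm.failed⟩ .R ≤ (1 - Γ.δ) * Γ.g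
      + Γ.δ * (Γ.lam * Γ.g + (1 - Γ.lam) * (r * (Γ.lam *
        Γ.val σ ⟨.G, .risky true :: (Arm.R :: h).map Arm.failed⟩ + (1 - Γ.lam) *
        Γ.val σ ⟨.G, (Arm.R :: Arm.R :: h).map Arm.failed⟩))) := by
    have h1 : Γ.next σ (Γ.val σ) ⟨.G, (Arm.R :: h).map Arm.failed⟩ = r * (Γ.lam *
        Γ.val σ ⟨.G, .risky true :: (Arm.R :: h).map Arm.failed⟩ + (1 - Γ.lam) *
        Γ.val σ ⟨.G, (Arm.R :: Arm.R :: h).map Arm.failed⟩) := by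
      have h2 := hz .G
      simp only [List.map_cons, Arm.failed] at h2 hr ⊢
      simp only [next, expVal, h2, ← hr]
      ring
    have h3 := Γ.next_val_good_le σ (.risky true :: h.map Arm.failed)
    rw [← h1]
    simp only [qval, gain, expVal, List.map_cons, Arm.failed]
    have := Γ.lam_pos
    have := Γ.δ_pos
    gcongr
  set o := Γ.odds (numExp h) with ho
  have ho0 : 0 < o := Γ.odds_pos _
  rw [excess, numExp_risky, odds_succ, odds_succ, ← ho] at he
  set vB := Γ.val σ ⟨.B, (Arm.R :: Arm.R :: h).map Arm.failed⟩
  set vG := Γ.val σ ⟨.G, (Arm.R :: Arm.R :: h).map Arm.failed⟩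
  set vX := Γ.val σ ⟨.G, .risky true :: (Arm.R :: h).map Arm.failed⟩
  have hδ := Γ.δ_pos
  have hu := sub_pos.2 Γ.lam_lt_one
  have h1 := mul_le_mul_of_nonneg_left hG ho0.le
  have hk : 0 ≤ Γ.δ * (Γ.lam * ((1 - Γ.lam) * o)) * Γ.g := by
    have := Γ.lam_pos; have := Γ.g_pos'; positivity
  -- The bracket is the excess plus the value of waiting. Its upper bound is nonnegative, so the
  -- probability `r` of a reply by `R` may be replaced by 1.
  have h2 : r * (vB + (1 - Γ.lam) * ((1 - Γ.lam) * o) * vG + Γ.lam * ((1 - Γ.lam) * o) * vX)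
      ≤ D + Γ.δ * (Γ.lam * ((1 - Γ.lam) * o)) * Γ.g := by
    have : vB + (1 - Γ.lam) * ((1 - Γ.lam) * o) * vG + Γ.lam * ((1 - Γ.lam) * o) * vX
      ≤ D + Γ.δ * (Γ.lam * ((1 - Γ.lam) * o)) * Γ.g := by linarith
    calc _ ≤ r * (D + Γ.δ * (Γ.lam * ((1 - Γ.lam) * o)) * Γ.g) :=
          mul_le_mul_of_nonneg_left this hr0
      _ ≤ 1 * _ := mul_le_mul_of_nonneg_right hr1 (by linarith)
      _ = _ := one_mul _
  have h3 := mul_le_mul_of_nonneg_left h2 hδ.le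
  rw [hB, den]
  nlinarith

/-- Contraction: waiting has no excess, and an experiment loses at the current odds apart from a
discounted later excess. When the other player has just succeeded, experimenting instead of waiting
gains only (1 - δ)g ≤ g · `den`; the corresponding part λo of the odds and the remainder (1 - λ)o
add up to o, which is at most the cut-off. -/
theorem excess_nonpos {n : ℕ} (hn : Γ.odds n * (Γ.g * Γ.den) ≤ (1 - Γ.δ) * Γ.c)
    (hs : ∀ h', n < numExp h' → riskProb σ ((Arm.S :: h').map Arm.failed) = 0) :
    ∀ h, n < numExp h → excess Γ σ h ≤ 0 := by
  have hlam := Γ.lam_pos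
  have hu := sub_pos.2 Γ.lam_lt_one
  have hδ := Γ.δ_pos
  have hδ1 := sub_pos.2 Γ.δ_lt_one
  have hg := Γ.g_pos'
  have hden := Γ.one_sub_delta_le_den
  have hc := Γ.c_pos
  have hod : ∀ h, n < numExp h → Γ.odds (numExp h) * (Γ.g * Γ.den) ≤ (1 - Γ.δ) * Γ.c :=
    fun h hh => (mul_le_mul_of_nonneg_right (Γ.odds_antitone hh.le)
      (mul_pos hg Γ.den_pos).le).trans hn
  -- The crude bound `c`: bad-state values are at most 0, the two good-state weights add up to the
  -- odds o, and o · g ≤ c because 1 - δ ≤ `den`.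
  refine Γ.nonpos_of_contraction (M := Γ.c) (fun h hh => ?_) (fun D hD hyp h hh => ?_)
  · have h1 := Γ.val_bad_le σ ((Arm.R :: h).map Arm.failed)
    have h2 := Γ.val_good_le σ ((Arm.R :: h).map Arm.failed)
    have h3 := Γ.val_good_le σ (.risky true :: h.map Arm.failed)
    have ho := Γ.odds_pos (numExp h)
    have h4 := hod h hh
    have h5 : Γ.odds (numExp h) * Γ.g ≤ Γ.c := by
      have : Γ.odds (numExp h) * Γ.g * (1 - Γ.δ) ≤ Γ.c * (1 - Γ.δ) := by
        have := mul_le_mul_of_nonneg_left hden (mul_pos ho hg).le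
        nlinarith
      exact le_of_mul_le_mul_right this hδ1
    rw [excess, odds_succ]
    have h6 := mul_le_mul_of_nonneg_left h2 (mul_pos hu ho).le
    have h7 := mul_le_mul_of_nonneg_left h3 (mul_pos hlam ho).le
    have h8 : 0 ≤ Γ.δ * (Γ.lam * Γ.odds (numExp h)) * Γ.g := by positivity
    nlinarith
  · have hh' : n < numExp (Arm.R :: h) := by rw [numExp_risky]; omega
    have hq := qval_bad_add_odds_mul_qval_good_le (Γ := Γ) (σ := σ) (h := Arm.R :: h)
      (fun h' hlt => hs h' (by omega)) hD
      (hyp (Arm.R :: Arm.R :: h) (by rw [numExp_risky]; omega))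
    set ρ := riskProb σ ((Arm.R :: h).map Arm.failed) with hρ
    have hρ0 : 0 ≤ ρ := riskProb_nonneg _ _
    have hρ1 : ρ ≤ 1 := riskProb_le_one _ _
    -- An `S` is answered by `S`, after which play has stopped; so without a success only the event
    -- of an experiment, of probability `ρ`, contributes.
    have hv : ∀ θ, Γ.val σ ⟨θ, (Arm.R :: h).map Arm.failed⟩
        = ρ * Γ.qval σ ⟨θ, (Arm.R :: h).map Arm.failed⟩ .R := by
      intro θ
      have h1 : Γ.val σ ⟨θ, (Arm.S :: Arm.S :: Arm.R :: h).map Arm.failed⟩ = 0 :=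
        val_safe_failed_eq_zero (fun h' hn' => hs h' (by rw [hn', numExp_safe]; exact hh')) θ
      have h2 := hs (Arm.R :: h) hh'
      have h3 : Γ.qval σ ⟨θ, (Arm.R :: h).map Arm.failed⟩ .S = 0 := by
        simp only [List.map_cons, Arm.failed] at h1 h2 ⊢
        simp only [qval, next, h1, h2]
        ring
      rw [val_eq_qval, h3]
      simp only [← hρ]
      ring
    have hX : Γ.val σ ⟨.G, .risky true :: h.map Arm.failed⟩ ≤ ρ * Γ.g + (1 - ρ) * (Γ.δ * Γ.g) := by
      have h1 : riskProb σ (.risky true :: h.map Arm.failed) = ρ := riskProb_risky _ _ _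
      have h2 := Γ.qval_safe_good_le σ (.risky true :: h.map Arm.failed)
      have h3 := Γ.qval_risky_good_le σ (.risky true :: h.map Arm.failed)
      rw [val_eq_qval]
      simp only [h1]
      have h4 := mul_le_mul_of_nonneg_left h2 (sub_nonneg.2 hρ1)
      have h5 := mul_le_mul_of_nonneg_left h3 hρ0
      linarith
    rw [numExp_risky, odds_succ] at hq
    rw [excess, hv, hv, odds_succ]
    have ho := Γ.odds_pos (numExp h)
    have h4 := hod h hh
    set o := Γ.odds (numExp h)
    have h5 := mul_le_mul_of_nonneg_left hq hρ0
    have h6 := mul_le_mul_of_nonneg_left hX (mul_pos hlam ho).le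
    have h7 : (1 - Γ.lam) * o * (Γ.g * Γ.den) + Γ.lam * o * Γ.g * (1 - Γ.δ)
        ≤ (1 - Γ.δ) * Γ.c := by
      have : Γ.lam * o * Γ.g * (1 - Γ.δ) ≤ Γ.lam * o * Γ.g * Γ.den :=
        mul_le_mul_of_nonneg_left hden (by positivity)
      nlinarith
    have h8 := mul_le_mul_of_nonneg_left h7 hρ0
    have h9 : ρ * (Γ.δ * D) ≤ 1 * (Γ.δ * D) :=
      mul_le_mul_of_nonneg_right hρ1 (by positivity)
    nlinarith

theorem Consistent.failed_belief_le_one (hC : Γ.Consistent σ π) (i : Player) (h : List Arm) :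
    Γ.odds (numExp h) * (π i (failView i h) ⟨.B, h.map Arm.failed⟩).toReal
      + (π i (failView i h) ⟨.B, h.map Arm.failed⟩).toReal ≤ 1 := by
  classical
  rw [← hC.good_eq_odds_mul]
  have := sum_le_hasSum {(⟨.G, h.map Arm.failed⟩ : FullHist), ⟨.B, h.map Arm.failed⟩}
    (fun _ _ => ENNReal.toReal_nonneg) (π i (failView i h)).hasSum_toReal
  rwa [Finset.sum_pair (by simp)] at this

/-- Value of an experiment at low odds, up to the possible past success of the other player. -/
theorem integral_qval_risky_le (hC : Γ.Consistent σ π) {h : List Arm} (i : Player)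
    (hs : ∀ h', numExp h < numExp h' → riskProb σ ((Arm.S :: h').map Arm.failed) = 0)
    (hn : Γ.odds (numExp h) * (Γ.g * Γ.den) ≤ (1 - Γ.δ) * Γ.c) :
    ∫ x, Γ.qval σ x .R ∂(π i (failView i h)).toMeasure ≤
      (π i (failView i h) ⟨.B, h.map Arm.failed⟩).toReal
          * (Γ.odds (numExp h) * (Γ.g * Γ.den) - (1 - Γ.δ) * Γ.c)
        + (1 - (π i (failView i h) ⟨.B, h.map Arm.failed⟩).toReal
          - Γ.odds (numExp h) * (π i (failView i h) ⟨.B, h.map Arm.failed⟩).toReal) * Γ.g := by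
  have h1 := (π i (failView i h)).integral_le_of_two_points (fun x => Γ.qval_bound' σ x .R)
    (a := ⟨.B, h.map Arm.failed⟩) (b := ⟨.G, h.map Arm.failed⟩) (by simp) (k := Γ.g) (by
      rintro ⟨θ, m⟩ hx hB -
      cases θ
      · exact Γ.qval_risky_good_le _ _
      · exact absurd (hC.eq_map_failed hx rfl) hB)
  rw [hC.good_eq_odds_mul] at h1
  have h2 := qval_bad_add_odds_mul_qval_good_le hs le_rfl
    (excess_nonpos hn hs (Arm.R :: h) (by rw [numExp_risky]; omega))
  have h3 := mul_le_mul_of_nonneg_left h2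
    (ENNReal.toReal_nonneg (a := π i (failView i h) ⟨.B, h.map Arm.failed⟩))
  linarith

theorem contPayoff_safe_eq_zero (i : Player) (σ : Profile) (μ : PMF FullHist)
    (hμ : ∀ y, μ y ≠ 0 → active y.moves.length = i) :
    Γ.contPayoff (Function.update σ i fun _ => PMF.pure .S) μ = 0 := by
  rw [contPayoff_eq_integral]
  refine integral_eq_zero_of_ae (PMF.ae_of_forall_ne_zero _ fun x hx => ?_)
  refine Γ.val_eq_zero_of_safe (P := fun m => active m.length = i) x.state (fun m hm => ⟨?_, ?_⟩)
    (fun m hm _ s => ?_) (hμ x hx)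
  · rw [riskProb_update_self hm]; simp
  · simpa using hm
  · simpa using hm

theorem active_of_ne_zero (hC : Γ.Consistent σ π) {i : Player} {h : List Move}
    (hi : active h.length = i) {y : FullHist} (hy : π i (view i h) y ≠ 0) :
    active y.moves.length = i := by
  have := congrArg List.length (hC.view_eq hy)
  rw [length_view, length_view] at this
  rw [this, hi]

theorem contPayoff_nonneg (hSE : Γ.IsSequentialEquilibrium σ π) {i : Player} {h : List Move}
    (hi : active h.length = i) : 0 ≤ Γ.contPayoff σ (π i (view i h)) :=
  (contPayoff_safe_eq_zero i σ _ fun _ hy => active_of_ne_zero hSE.2 hi hy).symm.le.trans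
    (hSE.1 i h hi _)

/-- In this form reasonableness says that the two failed histories carry the whole belief: no mass
is left for a success of the other player. -/
theorem bad_belief_after_safe (hC : Γ.Consistent σ π) (hR : Γ.Reasonable π) (h : List Arm) :
    (π (active (Arm.S :: h).length) (failView (active (Arm.S :: h).length) (Arm.S :: h))
      ⟨.B, (Arm.S :: h).map Arm.failed⟩).toReal * (1 + Γ.odds (numExp h)) = 1 := by
  have h1 := (hR h).1
  rw [hC.pubBelief_eq, phi_iterate] at h1
  have := Γ.odds_pos (numExp h)
  have h2 : (π (active (Arm.S :: h).length) (failView (active (Arm.S :: h).length) (Arm.S :: h))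
      ⟨.B, (Arm.S :: h).map Arm.failed⟩).toReal
      = 1 - Γ.odds (numExp h) / (1 + Γ.odds (numExp h)) := by linarith
  rw [h2]
  field_simp
  ring

/-- After the other player chose `S` at low odds, an unsuccessful player does not experiment. -/
theorem riskProb_after_safe_eq_zero (hSE : Γ.IsSequentialEquilibrium σ π) (hR : Γ.Reasonable π)
    (h : List Arm) (hn : Γ.odds (numExp h) * (Γ.g * Γ.den) < (1 - Γ.δ) * Γ.c) :
    riskProb σ ((Arm.S :: h).map Arm.failed) = 0 := by
  have hg := Γ.g_pos'
  -- From `N` experiments on, even the top payoff g in the good state does not compensate for the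
  -- cost; the backward induction starts there.
  obtain ⟨N, hN⟩ := Γ.exists_odds_mul_lt Γ.g (mul_pos (sub_pos.2 Γ.δ_lt_one) Γ.c_pos)
  induction hd : N - numExp h using Nat.strong_induction_on generalizing h with
  | _ d ih =>
  by_contra h0
  set i := active ((Arm.S :: h).map Arm.failed).length with hi
  have hi' : active (Arm.S :: h).length = i := by simp [hi]
  have h1 := Γ.contPayoff_le_of_riskProb_ne_zero hSE.1 hi.symm (fun _ => hSE.2.view_eq) h0
  have h2 := contPayoff_nonneg hSE hi.symm
  have h3 := bad_belief_after_safe hSE.2 hR h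
  rw [hi'] at h3
  have ho := Γ.odds_pos (numExp h)
  have hb : 0 < (π i (failView i (Arm.S :: h)) ⟨.B, (Arm.S :: h).map Arm.failed⟩).toReal := by
    by_contra hb
    have : (π i (failView i (Arm.S :: h)) ⟨.B, (Arm.S :: h).map Arm.failed⟩).toReal = 0 :=
      le_antisymm (not_lt.1 hb) ENNReal.toReal_nonneg
    rw [this] at h3; simp at h3
  by_cases hd0 : N ≤ numExp h
  · have h4 := (π i (failView i (Arm.S :: h))).integral_le_of_two_points
      (fun x => Γ.qval_bound' σ x .R)
      (a := ⟨.B, (Arm.S :: h).map Arm.failed⟩) (b := ⟨.G, (Arm.S :: h).map Arm.failed⟩) (by simp)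
      (k := Γ.g) (by
        rintro ⟨θ, m⟩ hx hB -
        cases θ
        · exact Γ.qval_risky_good_le _ _
        · exact absurd (hSE.2.eq_map_failed hx rfl) hB)
    rw [hSE.2.good_eq_odds_mul, numExp_safe] at h4
    have h5 := Γ.qval_risky_bad_le σ ((Arm.S :: h).map Arm.failed)
    have h6 := Γ.qval_risky_good_le σ ((Arm.S :: h).map Arm.failed)
    have h7 : Γ.odds (numExp h) * Γ.g < (1 - Γ.δ) * Γ.c :=
      (mul_le_mul_of_nonneg_right (Γ.odds_antitone hd0) hg.le).trans_lt hN
    change _ ≤ ∫ x, Γ.qval σ x .R ∂(π i (failView i (Arm.S :: h))).toMeasure at h1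
    have h8 := mul_le_mul_of_nonneg_left h6 ho.le
    have h9 := mul_lt_mul_of_pos_left (h5.trans_lt (neg_lt_neg h7)) hb
    have h10 := mul_le_mul_of_nonneg_left h8 hb.le
    nlinarith
  · have h4 := integral_qval_risky_le hSE.2 (h := Arm.S :: h) i (fun h' hlt => by
      rw [numExp_safe] at hlt
      refine ih (N - numExp h') (by omega) h' ?_ rfl
      exact (mul_le_mul_of_nonneg_right (Γ.odds_antitone hlt.le)
        (mul_pos hg Γ.den_pos).le).trans_lt hn) (by rw [numExp_safe]; exact hn.le)
    rw [numExp_safe] at h4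
    change _ ≤ ∫ x, Γ.qval σ x .R ∂(π i (failView i (Arm.S :: h))).toMeasure at h1
    have h5 := mul_lt_mul_of_pos_left hn hb
    nlinarith

/-! ### Pure deviations -/

open Classical in
/-- The pure strategy that experiments exactly at the private histories in `c`. -/
noncomputable def condStrat (c : PrivHist → Prop) : Strategy :=
  fun w => PMF.pure (if c w then .R else .S)

theorem riskProb_condStrat_pos {c : PrivHist → Prop} {i : Player} {m : List Move}
    (hi : active m.length = i) (h : c (view i m)) :
    riskProb (Function.update σ i (condStrat c)) m = 1 := by
  rw [riskProb_update_self hi]; simp [condStrat, h]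

theorem riskProb_condStrat_neg {c : PrivHist → Prop} {i : Player} {m : List Move}
    (hi : active m.length = i) (h : ¬ c (view i m)) :
    riskProb (Function.update σ i (condStrat c)) m = 0 := by
  rw [riskProb_update_self hi]; simp [condStrat, h]

/-- The `k`-th move, counted from the start, was seen as a choice of `R` by the other player. -/
def SawRisky (k : ℕ) (v : PrivHist) : Prop := v.reverse[k]? = some (Sum.inr Arm.R)

theorem SawRisky.cons {k : ℕ} {v : PrivHist} (h : SawRisky k v) (x : Move ⊕ Arm) :
    SawRisky k (x :: v) := by
  have hk : k < v.reverse.length := (List.getElem?_eq_some_iff.1 h).1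
  rw [SawRisky, List.reverse_cons, List.getElem?_append_left hk]
  exact h

theorem sawRisky_of_cons {k : ℕ} {v : PrivHist} {x : Move ⊕ Arm} (hk : k < v.length)
    (h : SawRisky k (x :: v)) : SawRisky k v := by
  rw [SawRisky, List.reverse_cons, List.getElem?_append_left (by simpa using hk)] at h
  exact h

theorem lt_length_of_sawRisky {k : ℕ} {v : PrivHist} (h : SawRisky k v) : k < v.length := by
  simpa using (List.getElem?_eq_some_iff.1 h).1

theorem sawRisky_cons_length {v : PrivHist} {x : Move ⊕ Arm} :
    SawRisky v.length (x :: v) ↔ x = Sum.inr Arm.R := by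
  rw [SawRisky, List.reverse_cons, List.getElem?_append_right (by simp)]
  simp

/-- Following the rule to experiment iff the other player chose `R` in move `k` yields `g` in the
good state if he did. -/
theorem val_good_of_sawRisky {c : PrivHist → Prop} {i : Player} {k : ℕ}
    (hc : ∀ w, SawRisky k w → c w) {m : List Move} (hi : active m.length = i)
    (h : SawRisky k (view i m)) :
    Γ.val (Function.update σ i (condStrat c)) ⟨.G, m⟩ = Γ.g :=
  Γ.val_good_eq_of_risky (P := fun m => active m.length = i ∧ SawRisky k (view i m))
    (fun m hm y z => ⟨by simpa using hm.1, (hm.2.cons _).cons _⟩)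
    (fun m hm => riskProb_condStrat_pos hm.1 (hc _ hm.2)) ⟨hi, h⟩

/-- A rule that prescribes `S` once and for all yields `0`. -/
theorem val_eq_zero_of_not_cond {c : PrivHist → Prop} {i : Player} {k : ℕ}
    (hcl : ∀ v a, k ≤ v.length → ¬ c v → ¬ c (Sum.inr a :: Sum.inl .safe :: v))
    {m : List Move} (hi : active m.length = i) (hk : k ≤ m.length) (h : ¬ c (view i m))
    (θ : State) : Γ.val (Function.update σ i (condStrat c)) ⟨θ, m⟩ = 0 := by
  have hstep : ∀ m : List Move, active m.length = i ∧ k ≤ m.length ∧ ¬ c (view i m) →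
      ∀ z : Move, active (z :: .safe :: m : List Move).length = i
        ∧ k ≤ (z :: .safe :: m : List Move).length ∧ ¬ c (view i (z :: .safe :: m)) := by
    rintro m ⟨h1, h2, h3⟩ z
    refine ⟨by simpa using h1, by simp; omega, ?_⟩
    rw [view_cons_other (by rw [← h1]; simpa using active_succ _), view_cons_own h1]
    exact hcl _ _ (by rwa [length_view]) h3
  exact Γ.val_eq_zero_of_safe (P := fun m => active m.length = i ∧ k ≤ m.length ∧
    ¬ c (view i m)) θ
    (fun m hm => ⟨riskProb_condStrat_neg hm.1 hm.2.2, hstep m hm _⟩)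
    (fun m hm _ s => hstep m hm _) ⟨hi, hk, h⟩

/-! ### Waiting for the other player's reaction -/

/-- If unsuccessful opponents choose `S` after `S`, choosing `S` reveals their past success. -/
theorem le_contPayoff_of_waiting (hSE : Γ.IsSequentialEquilibrium σ π) {h : List Arm} {i : Player}
    (hi : active h.length = i) (h0 : riskProb σ ((Arm.S :: h).map Arm.failed) = 0) :
    (1 - (π i (failView i h) ⟨.B, h.map Arm.failed⟩).toReal
      - Γ.odds (numExp h) * (π i (failView i h) ⟨.B, h.map Arm.failed⟩).toReal) * (Γ.δ * Γ.g)
      ≤ Γ.contPayoff σ (π i (failView i h)) := by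
  have hi' : active (h.map Arm.failed).length = i := by simpa using hi
  -- Moves are counted from 0, so move `h.length` is the present one and `h.length + 1` is the
  -- reply. The rule plays `S` now and afterwards experiments iff the reply was `R`.
  refine le_trans ?_ (hSE.1 i (h.map Arm.failed) hi' (condStrat (SawRisky (h.length + 1))))
  set σ' := Function.update σ i (condStrat (SawRisky (h.length + 1))) with hσ'
  rw [contPayoff_eq_integral, ← hSE.2.good_eq_odds_mul]
  have hother : active (h.length + 1) ≠ i := hi ▸ active_succ _
  have hfirst : ∀ m : List Move, m.length = h.length → ∀ θ, Γ.val σ' ⟨θ, m⟩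
      = Γ.δ * Γ.next σ' (Γ.val σ') ⟨θ, .safe :: m⟩ := by
    intro m hm θ
    have : riskProb σ' m = 0 := riskProb_condStrat_neg (by rw [hm, hi]) fun hs => by
      have := lt_length_of_sawRisky hs
      rw [length_view] at this; omega
    rw [val_eq_qval, this, qval]
    ring
  have hzero : ∀ θ, Γ.val σ' ⟨θ, h.map Arm.failed⟩ = 0 := by
    intro θ
    rw [hfirst _ (by simp) θ]
    have h1 : riskProb σ' (.safe :: h.map Arm.failed) = 0 := by
      rw [hσ', riskProb_update_other (by simpa using hother)]; exact h0
    have h2 : Γ.val σ' ⟨θ, .safe :: .safe :: h.map Arm.failed⟩ = 0 := by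
      refine val_eq_zero_of_not_cond (k := h.length + 2) (fun v a hk hv hs => hv ?_)
        (by simpa using hi) (by simp) (fun hs => ?_) θ
      · exact sawRisky_of_cons (by omega) (sawRisky_of_cons (by simp; omega) hs)
      rw [view_cons_other (by simpa using hother)] at hs
      have h3 : (view i (.safe :: h.map Arm.failed)).length = h.length + 1 := by
        simp [length_view]
      rw [← h3, sawRisky_cons_length] at hs
      simp [Move.arm] at hs
    simp only [next, h1, h2]
    ring
  have h1 := (π i (failView i h)).le_integral_of_two_points (fun x => Γ.val_bound σ' x)
    (a := ⟨.B, h.map Arm.failed⟩) (b := ⟨.G, h.map Arm.failed⟩) (by simp) (k := Γ.δ * Γ.g) (by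
      rintro ⟨θ, m⟩ hx hB hG
      cases θ
      · have hv := hSE.2.view_eq hx
        have hl : m.length = h.length := by
          simpa [length_view] using congrArg List.length hv
        rcases eq_map_failed_or_succ hv with rfl | ⟨j, hj, hs⟩
        · exact absurd rfl hG
        have hj' : j = active (m.length + 1) := eq_active_of_ne (by rw [hl, hi]; exact hj)
        rw [hfirst m hl]
        have h2 : riskProb σ' (.safe :: m) = 1 := by
          rw [hσ', riskProb_update_other (by simpa [hl] using hother)]
          exact riskProb_eq_one_of_succ hSE (by simpa [← hj'] using hs.cons .safe)
        have h3 : ∀ s, Γ.val σ' ⟨.G, .risky s :: .safe :: m⟩ = Γ.g := by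
          intro s
          refine val_good_of_sawRisky (fun _ h => h) (by simpa [hl] using hi) ?_
          rw [view_cons_other (by simpa [hl] using hother)]
          have h4 : (view i (.safe :: m)).length = h.length + 1 := by simp [length_view, hl]
          rw [← h4, sawRisky_cons_length]; rfl
        simp only [next, h2, expVal, h3]
        exact le_of_eq (by ring)
      · exact absurd (hSE.2.eq_map_failed hx rfl) hB)
  rw [hzero, hzero] at h1
  change _ ≤ ∫ x, Γ.val σ' x ∂(π i (failView i h)).toMeasure
  linarith

/-- Below the encouragement cut-off, an unsuccessful player does not experiment. -/
theorem riskProb_eq_zero_of_lt_pHat (hSE : Γ.IsSequentialEquilibrium σ π) (hR : Γ.Reasonable π)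
    (h : List Arm) (hp : pubBelief π (active h.length) h < Γ.pHat) :
    riskProb σ (h.map Arm.failed) = 0 := by
  by_contra h0
  set i := active h.length with hi
  have hi' : active (h.map Arm.failed).length = i := by simp [hi]
  rw [lt_pHat_iff, hSE.2.pubBelief_eq] at hp
  have hX := hSE.2.failed_belief_le_one i h
  have hb0 : 0 ≤ (π i (failView i h) ⟨.B, h.map Arm.failed⟩).toReal := ENNReal.toReal_nonneg
  have hgd := mul_pos Γ.g_pos' Γ.den_pos
  -- A success of the other player can only raise the belief, so a belief below the cut-off forces
  -- the odds computed from failures alone below it.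
  have hlow : Γ.odds (numExp h) * (Γ.g * Γ.den) < (1 - Γ.δ) * Γ.c := by
    set b := (π i (failView i h) ⟨.B, h.map Arm.failed⟩).toReal
    have hb : 0 < b := by
      refine lt_of_le_of_ne hb0 fun hb => ?_
      rw [← hb] at hp; nlinarith
    have h1 : b * (Γ.odds (numExp h) * (Γ.g * Γ.den)) < b * ((1 - Γ.δ) * Γ.c) := by
      have := mul_le_mul_of_nonneg_right hX hgd.le
      nlinarith
    exact lt_of_mul_lt_mul_left h1 hb.le
  have h1 := Γ.contPayoff_le_of_riskProb_ne_zero hSE.1 hi' (fun _ => hSE.2.view_eq) h0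
  have h2 := le_contPayoff_of_waiting hSE hi.symm (riskProb_after_safe_eq_zero hSE hR h hlow)
  have h3 := integral_qval_risky_le hSE.2 i (fun h' hlt => riskProb_after_safe_eq_zero hSE hR h'
    ((mul_le_mul_of_nonneg_right (Γ.odds_antitone hlt.le) hgd.le).trans_lt hlow)) hlow.le
  have h4 := (h2.trans h1).trans h3
  set b := (π i (failView i h) ⟨.B, h.map Arm.failed⟩).toReal
  -- With X = 1 - b - o b, optimality of `R` gives 0 ≤ b(o g `den` - (1 - δ)c) + X(1 - δ)g.
  -- Replacing 1 - δ by `den` yields b(1 - δ)c ≤ (1 - b) g `den`, which contradicts `hp`.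
  have h5 := mul_le_mul_of_nonneg_left Γ.one_sub_delta_le_den
    (mul_nonneg (by linarith : 0 ≤ 1 - b - Γ.odds (numExp h) * b) Γ.g_pos'.le)
  nlinarith

end ExpGame

namespace ExpGame

variable {Γ : ExpGame} {σ : Profile} {π : Beliefs}

/-! ### The law of the infinite play -/

/-- The Markov property at time `n`, read off from the disintegration of the trajectory measure. -/
theorem playLaw_inter (σ : Profile) (n : ℕ) (s t : Set FullHist) :
    Γ.playLaw σ {ω | ω n ∈ s ∧ ω (n + 1) ∈ t}
      = ∫⁻ ω in {ω | ω n ∈ s}, (Γ.step σ (ω n)).toMeasure t ∂Γ.playLaw σ := by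
  have hκ := Kernel.map_frestrictLe_trajMeasure_compProd_eq_map_trajMeasure
    (X := fun _ => FullHist) (μ₀ := Γ.init.toMeasure) (a := n)
    (κ := fun n => (Γ.stepKernel σ).comap (fun z : Finset.Iic n → FullHist => z ⟨n, by simp⟩)
      (measurable_pi_apply _))
  set A : Set (Finset.Iic n → FullHist) := {z | z ⟨n, by simp⟩ ∈ s} with hA
  have hAm : MeasurableSet A :=
    (measurable_pi_apply (⟨n, by simp⟩ : Finset.Iic n)) (MeasurableSet.of_discrete (s := s))
  have htm : MeasurableSet t := MeasurableSet.of_discrete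
  have h1 := congrArg (fun μ => μ (A ×ˢ t)) hκ
  beta_reduce at h1
  rw [Measure.compProd_apply_prod hAm htm, Measure.map_apply (by fun_prop) (hAm.prod htm),
    setLIntegral_map hAm (Kernel.measurable_coe _ htm) (by fun_prop)] at h1
  exact h1.symm

instance : Countable FullHist := by
  have h1 : Function.Injective fun θ : State => decide (θ = .G) := by
    rintro (_ | _) (_ | _) h <;> simp_all
  have h2 : Function.Injective fun x : Move => match x with
    | .safe => (none : Option Bool)
    | .risky s => some s := by
    rintro (_ | _) (_ | _) h <;> simp_all
  have := h1.countable
  have := h2.countable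
  exact Function.Injective.countable (f := fun x : FullHist => (x.state, x.moves)) (by
    rintro ⟨_, _⟩ ⟨_, _⟩ h; simpa using h)

theorem playLaw_zero (σ : Profile) (s : Set FullHist) :
    Γ.playLaw σ {ω | ω 0 ∈ s} = Γ.init.toMeasure s := by
  have hs : MeasurableSet s := MeasurableSet.of_discrete
  have h1 : (Γ.playLaw σ).map (Preorder.frestrictLe 0)
      = Γ.init.toMeasure.map (MeasurableEquiv.piUnique fun _ : Finset.Iic 0 => FullHist).symm := by
    rw [playLaw, Kernel.trajMeasure, Measure.map_comp _ _ (by fun_prop),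
      Kernel.traj_map_frestrictLe, Kernel.partialTraj_self, Measure.id_comp]
  have h2 := congrArg (fun μ => μ {z | z ⟨0, by simp⟩ ∈ s}) h1
  beta_reduce at h2
  have hm : MeasurableSet {z : Finset.Iic 0 → FullHist | z ⟨0, by simp⟩ ∈ s} :=
    (measurable_pi_apply (⟨0, by simp⟩ : Finset.Iic 0)) hs
  rw [Measure.map_apply (by fun_prop) hm, Measure.map_apply (by fun_prop) hm] at h2
  exact h2

theorem playLaw_apply_eq (σ : Profile) (n : ℕ) (s : Set FullHist) :
    Γ.playLaw σ {ω | ω n ∈ s} = (Γ.evolve σ Γ.init n).toMeasure s := by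
  induction n generalizing s with
  | zero => exact playLaw_zero σ s
  | succ n ih =>
    have hmap : (Γ.playLaw σ).map (fun ω => ω n) = (Γ.evolve σ Γ.init n).toMeasure := by
      ext t ht
      rw [Measure.map_apply (measurable_pi_apply n) ht, ← ih t]
      rfl
    have h1 := playLaw_inter (Γ := Γ) σ n Set.univ s
    simp only [Set.mem_univ, true_and, Set.ofPred_true, Measure.restrict_univ] at h1
    rw [h1, evolve, PMF.toMeasure_bind_apply _ _ _ MeasurableSet.of_discrete,
      ← lintegral_map (f := fun x => (Γ.step σ x).toMeasure s) Measurable.of_discrete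
        (measurable_pi_apply n), hmap, lintegral_countable']
    refine tsum_congr fun x => ?_
    rw [PMF.toMeasure_apply_singleton _ _ MeasurableSet.of_discrete, mul_comm]

/-- A path that is reached with positive probability and then followed for sure has positive
probability. -/
theorem playLaw_path_pos {L : ℕ} {y : ℕ → FullHist} (h0 : Γ.evolve σ Γ.init L (y 0) ≠ 0)
    (hstep : ∀ k, Γ.step σ (y k) (y (k + 1)) = 1) :
    0 < Γ.playLaw σ {ω | ∀ k, ω (L + k) = y k} := by
  -- Each step off the prescribed path has probability zero, and there are countably many steps.
  have hleave : ∀ k, Γ.playLaw σ {ω | ω (L + k) ∈ ({y k} : Set FullHist) ∧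
      ω (L + k + 1) ∈ ({y (k + 1)} : Set FullHist)ᶜ} = 0 := by
    intro k
    rw [playLaw_inter]
    have hm : MeasurableSet {ω : ℕ → FullHist | ω (L + k) ∈ ({y k} : Set FullHist)} :=
      (measurable_pi_apply (L + k)) (MeasurableSet.of_discrete (s := {y k}))
    rw [setLIntegral_congr_fun (g := fun _ => 0) hm]
    · simp
    · intro ω hω
      have hω' : ω (L + k) = y k := hω
      simp only [hω']
      rw [prob_compl_eq_zero_iff MeasurableSet.of_discrete,
        PMF.toMeasure_apply_singleton _ _ MeasurableSet.of_discrete, hstep k]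
  have hsub : {ω : ℕ → FullHist | ω L ∈ ({y 0} : Set FullHist)} ⊆ {ω | ∀ k, ω (L + k) = y k} ∪
      ⋃ k, {ω | ω (L + k) ∈ ({y k} : Set FullHist) ∧
        ω (L + k + 1) ∈ ({y (k + 1)} : Set FullHist)ᶜ} := by
    intro ω hω
    by_cases hall : ∀ k, ω (L + k) = y k
    · exact Or.inl hall
    · right
      by_contra hno
      refine hall fun k => ?_
      induction k with
      | zero => exact hω
      | succ k ih =>
        by_contra hk
        exact hno (Set.mem_iUnion.2 ⟨k, ih, hk⟩)
  have h1 := measure_mono (μ := Γ.playLaw σ) hsub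
  rw [playLaw_apply_eq, PMF.toMeasure_apply_singleton _ _ MeasurableSet.of_discrete] at h1
  have h2 := h1.trans (measure_union_le _ _)
  rw [measure_iUnion_null hleave, add_zero] at h2
  exact (pos_iff_ne_zero.2 h0).trans_le h2

/-! ### Histories reached in the bad state -/

theorem wt_risky (τ : Profile) (θ : State) (s : Bool) (m : List Move) :
    Γ.wt τ θ (.risky s :: m) = Γ.wt τ θ m * riskProb τ m * Γ.outProb θ (.risky s) := rfl

theorem wt_safe (τ : Profile) (θ : State) (m : List Move) :
    Γ.wt τ θ (.safe :: m) = Γ.wt τ θ m * (1 - riskProb τ m) := by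
  rw [wt, outProb, mul_one, Move.arm, toReal_safe]; rfl

variable (Γ σ) in
/-- The public history `h` has positive probability in the bad state. -/
def Reach (h : List Arm) : Prop := Γ.wt σ .B (h.map Arm.failed) ≠ 0

theorem wt_bad_risky (h : List Arm) : Γ.wt σ .B ((Arm.R :: h).map Arm.failed)
    = Γ.wt σ .B (h.map Arm.failed) * riskProb σ (h.map Arm.failed) := by
  simp only [List.map_cons, Arm.failed, wt_risky, outProb, mul_one]

theorem wt_bad_safe (h : List Arm) : Γ.wt σ .B ((Arm.S :: h).map Arm.failed)
    = Γ.wt σ .B (h.map Arm.failed) * (1 - riskProb σ (h.map Arm.failed)) := by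
  simp only [List.map_cons, Arm.failed, wt_safe]

theorem reach_nil : Reach Γ σ [] := (Γ.prior_pos .B).ne'

theorem reach_risky_iff {h : List Arm} :
    Reach Γ σ (.R :: h) ↔ Reach Γ σ h ∧ riskProb σ (h.map Arm.failed) ≠ 0 := by
  rw [Reach, wt_bad_risky, mul_ne_zero_iff, Reach]

theorem reach_safe_iff {h : List Arm} :
    Reach Γ σ (.S :: h) ↔ Reach Γ σ h ∧ riskProb σ (h.map Arm.failed) ≠ 1 := by
  rw [Reach, wt_bad_safe, mul_ne_zero_iff, Reach, sub_ne_zero, ne_comm (a := (1 : ℝ))]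

theorem numExp_replicate_append (k : ℕ) (h : List Arm) :
    numExp (List.replicate k .S ++ h) = numExp h := by
  induction k with
  | zero => rfl
  | succ k ih => rw [List.replicate_succ, List.cons_append, numExp_safe, ih]

theorem reach_replicate_append {h : List Arm} (hh : Reach Γ σ h)
    (hs : ∀ k, riskProb σ ((List.replicate k Arm.S ++ h).map Arm.failed) = 0) (k : ℕ) :
    Reach Γ σ (List.replicate k .S ++ h) := by
  induction k with
  | zero => exact hh
  | succ k ih =>
    rw [List.replicate_succ, List.cons_append, reach_safe_iff, hs k]
    exact ⟨ih, zero_ne_one⟩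

/-- On the equilibrium path, two consecutive choices of `S` reveal that no experiment succeeded. -/
theorem wt_safe_safe_eq_zero (hSE : Γ.IsSequentialEquilibrium σ π) (θ : State) {m : List Move}
    (hm : Move.risky true ∈ m) : Γ.wt σ θ (.safe :: .safe :: m) = 0 := by
  obtain ⟨j, hj⟩ := exists_succ_of_mem hm
  rw [wt_safe, wt_safe]
  by_cases hja : j = active m.length
  · rw [riskProb_eq_one_of_succ hSE (hja ▸ hj)]; ring
  · have : riskProb σ (.safe :: m) = 1 := by
      refine riskProb_eq_one_of_succ hSE ?_
      rw [List.length_cons, ← eq_active_of_ne hja]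
      exact hj.cons _
    rw [this]; ring

/-- Only two full histories are left, and the ratio of their masses is the odds. -/
theorem Consistent.bad_belief_mul_eq_one (hC : Γ.Consistent σ π) {i : Player} {h : List Arm}
    (hno : ∀ y, π i (failView i h) y ≠ 0 → y.moves = h.map Arm.failed) :
    (π i (failView i h) ⟨.B, h.map Arm.failed⟩).toReal * (1 + Γ.odds (numExp h)) = 1 := by
  have h1 := hC.failed_belief_le_one i h
  have h2 := (π i (failView i h)).integral_le_of_two_points (f := fun _ => 1) (C := 1) (by simp)
    (a := ⟨.B, h.map Arm.failed⟩) (b := ⟨.G, h.map Arm.failed⟩) (by simp) (k := 0) (by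
      rintro ⟨θ, m⟩ hx hB hG
      obtain rfl : m = _ := hno _ hx
      cases θ
      · exact absurd rfl hG
      · exact absurd rfl hB)
  rw [hC.good_eq_odds_mul] at h2
  simp only [integral_const, probReal_univ, smul_eq_mul, mul_one, mul_zero, add_zero] at h2
  linarith

/-- A full history with an earlier success has weight zero, since its author would have chosen `R`
at one of the last two moves; the failed history has positive weight. Bayes' rule excludes the
former. -/
theorem pubBelief_safe_safe (hSE : Γ.IsSequentialEquilibrium σ π) {h : List Arm}
    (hh : Reach Γ σ (.S :: .S :: h)) (i : Player) :
    pubBelief π i (.S :: .S :: h) = Γ.φ^[numExp h] Γ.p0 := by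
  have hC := hSE.2
  have h1 := hC.bad_belief_mul_eq_one (i := i) (h := .S :: .S :: h) (by
    rintro ⟨θ, m⟩ hx
    have ha := map_arm_eq_of_view_eq (hC.view_eq hx)
    rw [map_arm_map_failed] at ha
    have hm : Move.risky true ∉ m := by
      intro hm
      obtain ⟨m', rfl, hm'⟩ : ∃ m', m = .safe :: .safe :: m' ∧ Move.risky true ∈ m' := by
        rcases m with _ | ⟨x, _ | ⟨y, m'⟩⟩
        · simp at ha
        · simp at ha
        · rcases x with _ | _ <;> rcases y with _ | _ <;> simp [Move.arm] at ha
          exact ⟨m', rfl, by simpa using hm⟩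
      exact hx (hC.eq_zero (wt_safe_safe_eq_zero hSE θ hm')
        (h := (Arm.S :: .S :: h).map Arm.failed) rfl hh)
    have := ExpGame.eq_map_failed hm
    rwa [ha] at this)
  rw [hC.pubBelief_eq, phi_iterate]
  rw [numExp_safe, numExp_safe] at h1
  have ho := Γ.odds_pos (numExp h)
  rw [eq_div_iff (by positivity)]
  linarith

/-- If unsuccessful players choose `S` forever after a reached history, the final beliefs are the
common belief with positive probability. -/
theorem finalBelief_pos (hSE : Γ.IsSequentialEquilibrium σ π) {h : List Arm} (hh : Reach Γ σ h)
    (hs : ∀ k, riskProb σ ((List.replicate k Arm.S ++ h).map Arm.failed) = 0) :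
    0 < Γ.playLaw σ {ω | ∀ i, IsFinalBelief π i ω (Γ.φ^[numExp h] Γ.p0)} := by
  classical
  set y : ℕ → FullHist := fun k => ⟨.B, (List.replicate k Arm.S ++ h).map Arm.failed⟩ with hy
  have hpos := playLaw_path_pos (Γ := Γ) (σ := σ) (L := h.length) (y := y) (by
      simp only [hy]
      rw [evolve_init_apply, if_pos (by simp), ne_eq, ENNReal.ofReal_eq_zero, not_le]
      exact lt_of_le_of_ne (Γ.wt_nonneg _ _ _) (Ne.symm hh)) (fun k => by
      have h1 := hs k
      simp only [hy]
      rw [List.replicate_succ, List.cons_append, List.map_cons, step_apply_cons, if_pos rfl,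
        arm_failed, ← ENNReal.ofReal_toReal (PMF.apply_ne_top (σ _ _) _), toReal_safe]
      rw [riskProb] at h1
      rw [h1]
      simp [Arm.failed, outProb])
  refine hpos.trans_le (measure_mono fun ω hω i => ?_)
  refine tendsto_const_nhds.congr' ?_
  -- Two choices of `S` after `h` are needed before both players are known to be unsuccessful.
  filter_upwards [eventually_ge_atTop (h.length + 2)] with n hn
  obtain ⟨k, rfl⟩ : ∃ k, n = h.length + (k + 2) := ⟨n - (h.length + 2), by omega⟩
  have hω' : ω (h.length + (k + 2)) = y (k + 2) := hω (k + 2)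
  have hr := reach_replicate_append hh hs (k + 2)
  rw [List.replicate_succ, List.replicate_succ] at hr
  have hb := pubBelief_safe_safe hSE (h := List.replicate k Arm.S ++ h) hr i
  rw [numExp_replicate_append] at hb
  rw [hω', ← hb]
  rfl

/-! ### Perpetual experimentation destroys optimism -/

/-- `h` followed by `k` rounds in which both players experiment. -/
def addRounds (h : List Arm) : ℕ → List Arm
  | 0 => h
  | k + 1 => .R :: .R :: addRounds h k

theorem length_addRounds (h : List Arm) (k : ℕ) : (addRounds h k).length = h.length + 2 * k := by
  induction k with
  | zero => rfl
  | succ k ih => simp only [addRounds, List.length_cons, ih]; ring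

theorem active_addRounds (h : List Arm) (k : ℕ) :
    active (addRounds h k).length = active h.length := by
  induction k with
  | zero => rfl
  | succ k ih => simpa [addRounds] using ih

theorem numExp_addRounds (h : List Arm) (k : ℕ) :
    numExp (addRounds h k) = numExp h + 2 * k := by
  induction k with
  | zero => rfl
  | succ k ih => rw [addRounds, numExp_risky, numExp_risky, ih]; ring

/-- Number of failed own experiments in a private history. -/
def ownFails (v : PrivHist) : ℕ := v.countP fun e => decide (e = Sum.inl (.risky false))

/-- In the good state, each failure of player `i` has conditional probability at most `1 - λ`. -/
theorem good_viewProb_le (σ : Profile) (i : Player) (m : List Move) :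
    (Γ.evolve σ Γ.init m.length).toMeasure {x | x.state = .G ∧ view i x.moves = view i m}
      ≤ ENNReal.ofReal ((1 - Γ.lam) ^ (ownFails (view i m))) := by
  classical
  have hu := sub_pos.2 Γ.lam_lt_one
  induction m with
  | nil =>
    simp only [view, ownFails, List.countP_nil, pow_zero, ENNReal.ofReal_one]
    exact prob_le_one
  | cons x m ih =>
    set s : Set FullHist := {y | y.state = .G ∧ view i y.moves = view i m} with hsdef
    set t : Set FullHist := {y | y.state = .G ∧ view i y.moves = view i (x :: m)} with htdef
    -- The factor due to the newest entry: 1 - λ for an own failure, and the trivial bound 1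
    -- otherwise.
    set κ : ℝ := if active m.length = i ∧ x = .risky false then 1 - Γ.lam else 1 with hκ
    have hκ0 : 0 ≤ κ := by rw [hκ]; split_ifs <;> linarith
    have hcount : (1 - Γ.lam) ^ (ownFails (view i (x :: m)))
        = κ * (1 - Γ.lam) ^ (ownFails (view i m)) := by
      rw [hκ]
      by_cases ha : active m.length = i
      · rw [view_cons_own ha, ownFails, List.countP_cons, ownFails]
        by_cases hx : x = .risky false
        · simp [ha, hx, pow_succ']
        · simp [hx]
      · rw [view_cons_other ha, ownFails, List.countP_cons, ownFails]
        simp [ha]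
    have hstep : ∀ y, (Γ.step σ y).toMeasure t ≤ s.indicator (fun _ => ENNReal.ofReal κ) y := by
      intro y
      have hsupp : ∀ z ∈ t, Γ.step σ y z ≠ 0 → ∃ w, z = ⟨.G, w :: y.moves⟩ ∧ y ∈ s := by
        rintro ⟨θ, _ | ⟨w, m'⟩⟩ hz h0
        · simp [htdef, view] at hz
        · rw [step_apply_cons] at h0
          obtain rfl : y = ⟨θ, m'⟩ := by by_contra hne; simp [hne] at h0
          obtain ⟨rfl, hv⟩ : θ = .G ∧ _ := hz
          refine ⟨w, rfl, rfl, ?_⟩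
          simp only [view, List.cons.injEq] at hv
          exact hv.2
      by_cases hy : y ∈ s
      · rw [Set.indicator_of_mem hy]
        by_cases hx : active m.length = i ∧ x = .risky false
        · have h1 : (Γ.step σ y).toMeasure t
              ≤ (Γ.step σ y).toMeasure {⟨.G, .risky false :: y.moves⟩} := by
            refine PMF.toMeasure_mono _ MeasurableSet.of_discrete ?_
            rintro z ⟨hz, h0⟩
            obtain ⟨w, rfl, -⟩ := hsupp z hz h0
            have hl : y.moves.length = m.length := by
              simpa [length_view] using congrArg List.length hy.2
            have hv : view i (w :: y.moves) = view i (x :: m) := hz.2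
            rw [view_cons_own hx.1, view_cons_own (hl ▸ hx.1), hx.2] at hv
            simp only [List.cons.injEq, Sum.inl.injEq] at hv
            rw [hv.1]; rfl
          refine h1.trans ?_
          rw [PMF.toMeasure_apply_singleton _ _ MeasurableSet.of_discrete, step_apply_cons,
            hκ, if_pos hx]
          split_ifs
          · calc _ ≤ 1 * ENNReal.ofReal (1 - Γ.lam) := by
                  gcongr
                  · exact PMF.coe_le_one _ _
                  · exact le_rfl
              _ = _ := one_mul _
          · exact zero_le
        · rw [hκ, if_neg hx, ENNReal.ofReal_one]
          exact prob_le_one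
      · rw [Set.indicator_of_notMem hy, nonpos_iff_eq_zero,
          PMF.toMeasure_apply_eq_zero_iff _ MeasurableSet.of_discrete, Set.disjoint_left]
        intro z h0 hz
        obtain ⟨w, -, h⟩ := hsupp z hz h0
        exact hy h
    rw [List.length_cons, evolve, PMF.toMeasure_bind_apply _ _ _ MeasurableSet.of_discrete, hcount,
      ENNReal.ofReal_mul hκ0]
    calc _ ≤ ∑' y, ENNReal.ofReal κ * s.indicator (Γ.evolve σ Γ.init m.length) y := by
          refine ENNReal.tsum_le_tsum fun y => ?_
          refine (mul_le_mul_right (hstep y) _).trans (le_of_eq ?_)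
          by_cases hy : y ∈ s <;> simp [hy, mul_comm]
      _ = ENNReal.ofReal κ * (Γ.evolve σ Γ.init m.length).toMeasure s := by
          rw [ENNReal.tsum_mul_left, PMF.toMeasure_apply_eq_tsum]
      _ ≤ _ := by gcongr

/-- Bayes' rule summed over the good-state full histories in the information set. When the bad-state
weight stays bounded away from 0, own failures alone drive the belief to 0, whatever the other
player may have observed. -/
theorem Consistent.pubBelief_mul_le (hC : Γ.Consistent σ π) (i : Player) (h : List Arm) :
    pubBelief π i h * Γ.wt σ .B (h.map Arm.failed)
      ≤ (1 - Γ.lam) ^ (ownFails (failView i h)) := by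
  classical
  have h1 : (π i (failView i h)).toMeasure {x | x.state = .G}
      * ENNReal.ofReal (Γ.wt σ .B (h.map Arm.failed))
      ≤ ENNReal.ofReal ((1 - Γ.lam) ^ (ownFails (failView i h))) := by
    refine le_trans ?_ (good_viewProb_le σ i (h.map Arm.failed))
    rw [PMF.toMeasure_apply_eq_tsum, PMF.toMeasure_apply_eq_tsum, ← ENNReal.tsum_mul_right]
    refine ENNReal.tsum_le_tsum fun y => ?_
    by_cases hy : π i (failView i h) y = 0
    · have : Set.indicator {x : FullHist | x.state = .G} (π i (failView i h)) y = 0 := by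
        simp [Set.indicator, hy]
      rw [this, zero_mul]; exact zero_le
    · have hv := hC.view_eq hy
      by_cases hG : y.state = .G
      · rw [Set.indicator_of_mem (by exact hG), Set.indicator_of_mem (by exact ⟨hG, hv⟩)]
        have h2 := hC.mul_wt_le (h := h.map Arm.failed) y (θ := .B) (m := h.map Arm.failed) (i := i)
          rfl
        obtain ⟨θ, m⟩ := y
        rw [evolve_init_apply, if_pos]
        · exact h2
        · simpa [length_view] using congrArg List.length hv
      · rw [Set.indicator_of_notMem (by exact hG), zero_mul]; exact zero_le
  have h2 := ENNReal.toReal_mono ENNReal.ofReal_ne_top h1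
  rwa [ENNReal.toReal_mul, ENNReal.toReal_ofReal (Γ.wt_nonneg _ _ _),
    ENNReal.toReal_ofReal (pow_nonneg (sub_pos.2 Γ.lam_lt_one).le _)] at h2

theorem le_count_failView_addRounds {h : List Arm} {i : Player} (hi : active h.length = i) (k : ℕ) :
    k ≤ ownFails (failView i (addRounds h k)) := by
  induction k with
  | zero => exact Nat.zero_le _
  | succ k ih =>
    have h1 : active ((addRounds h k).map Arm.failed).length = i := by
      rw [List.length_map, active_addRounds, hi]
    have h2 : active ((Arm.R :: addRounds h k).map Arm.failed).length ≠ i := by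
      rw [← h1]; simpa using active_succ _
    have : failView i (addRounds h (k + 1)) = Sum.inr .R :: Sum.inl (.risky false) ::
        failView i (addRounds h k) := by
      rw [failView, addRounds, List.map_cons, view_cons_other h2, List.map_cons, view_cons_own h1]
      rfl
    rw [this, ownFails, List.countP_cons, List.countP_cons, ← ownFails]
    simp
    omega

/-- At low odds, somebody chooses `S` sooner or later. -/
theorem exists_reach_safe (hSE : Γ.IsSequentialEquilibrium σ π) (hR : Γ.Reasonable π)
    {h : List Arm} (hh : Reach Γ σ h) : ∃ h', numExp h ≤ numExp h' ∧ Reach Γ σ (.S :: h') := by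
  by_contra! hno
  have hforce : ∀ h', numExp h ≤ numExp h' → Reach Γ σ h' → riskProb σ (h'.map Arm.failed) = 1 := by
    intro h' hn hr
    by_contra h1
    exact hno h' hn (reach_safe_iff.2 ⟨hr, h1⟩)
  -- If `S` is never chosen, the bad-state play is deterministic from `h` on, so its weight does not
  -- decrease.
  have hwt : ∀ k, Γ.wt σ .B ((addRounds h k).map Arm.failed) = Γ.wt σ .B (h.map Arm.failed) := by
    intro k
    induction k with
    | zero => rfl
    | succ k ih =>
      have h1 : Reach Γ σ (addRounds h k) := by rw [Reach, ih]; exact hh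
      have h2 := hforce _ (by rw [numExp_addRounds]; omega) h1
      have h3 : Reach Γ σ (.R :: addRounds h k) := reach_risky_iff.2 ⟨h1, by rw [h2]; simp⟩
      have h4 := hforce _ (by rw [numExp_risky, numExp_addRounds]; omega) h3
      rw [addRounds, wt_bad_risky, wt_bad_risky, h2, h4, ih]
      ring
  have hC : 0 < Γ.wt σ .B (h.map Arm.failed) := lt_of_le_of_ne (Γ.wt_nonneg _ _ _) (Ne.symm hh)
  have hp : 0 < Γ.pHat := by
    rw [pHat_eq]
    exact div_pos (mul_pos Γ.c_pos (sub_pos.2 Γ.δ_lt_one)) Γ.pHat_den_pos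
  have hu := sub_pos.2 Γ.lam_lt_one
  have hu1 : 1 - Γ.lam < 1 := by linarith [Γ.lam_pos]
  -- After `k` own failures the belief is below the cut-off, where `R` cannot be chosen.
  obtain ⟨k, hk⟩ := exists_pow_lt_of_lt_one (mul_pos hp hC) hu1
  have h1 := hSE.2.pubBelief_mul_le (active h.length) (addRounds h k)
  rw [hwt] at h1
  have h2 : pubBelief π (active h.length) (addRounds h k) < Γ.pHat := by
    have h3 := pow_le_pow_of_le_one hu.le hu1.le
      (le_count_failView_addRounds (h := h) (i := active h.length) rfl k)
    exact lt_of_mul_lt_mul_right ((h1.trans h3).trans_lt hk) hC.le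
  have h4 := riskProb_eq_zero_of_lt_pHat hSE hR (addRounds h k) (by rwa [active_addRounds])
  have h5 := hforce (addRounds h k) (by rw [numExp_addRounds]; omega) (by rw [Reach, hwt]; exact hh)
  rw [h4] at h5
  exact zero_ne_one h5

end ExpGame

namespace ExpGame

variable {Γ : ExpGame} {σ : Profile} {π : Beliefs}

/-! ### Profitable experiments -/

theorem val_good_of_succ {c : PrivHist → Prop} {i : Player}
    (hc : ∀ w, Sum.inl (.risky true) ∈ w → c w) {m : List Move} (hi : active m.length = i)
    (h : Succ i m) : Γ.val (Function.update σ i (condStrat c)) ⟨.G, m⟩ = Γ.g :=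
  Γ.val_good_eq_of_risky (P := fun m => active m.length = i ∧ Succ i m)
    (fun m hm y z => ⟨by simpa using hm.1, (hm.2.cons _).cons _⟩)
    (fun m hm => riskProb_condStrat_pos hm.1 (hc _ hm.2)) ⟨hi, h⟩

theorem next_val_good_of_success {c : PrivHist → Prop} {i : Player}
    (hc : ∀ w, Sum.inl (.risky true) ∈ w → c w) {m : List Move} (hi : active m.length = i) :
    Γ.next (Function.update σ i (condStrat c)) (Γ.val (Function.update σ i (condStrat c)))
      ⟨.G, .risky true :: m⟩ = Γ.g := by
  have hv : ∀ y, Γ.val (Function.update σ i (condStrat c)) ⟨.G, y :: .risky true :: m⟩ = Γ.g := by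
    intro y
    refine val_good_of_succ hc (by simpa using hi) (Succ.cons ?_ _)
    rw [Succ, view_cons_own hi]
    exact List.mem_cons_self
  exact le_antisymm (Γ.next_le fun y => (hv y).le) (Γ.le_next fun y => (hv y).ge)

theorem val_eq_qval_risky {θ : State} {m : List Move} (h : riskProb σ m = 1) :
    Γ.val σ ⟨θ, m⟩ = Γ.qval σ ⟨θ, m⟩ .R := by
  rw [val_eq_qval, h]; ring

/-- Above the one-player cut-off, it cannot be that unsuccessful players never experiment. -/
theorem not_forall_safe (hSE : Γ.IsSequentialEquilibrium σ π) (hp : Γ.pStar < Γ.p0)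
    (hs : ∀ k, riskProb σ ((List.replicate k Arm.S).map Arm.failed) = 0) : False := by
  set i : Player := active 0 with hi
  have hC := hSE.2
  have hsupp : ∀ y, π i (failView i []) y ≠ 0 → y.moves = ([] : List Arm).map Arm.failed := by
    intro y hy
    have := congrArg List.length (hC.view_eq hy)
    rw [length_view, length_view] at this
    exact List.length_eq_zero_iff.1 this
  have hb := hC.bad_belief_mul_eq_one hsupp
  have hzero : Γ.contPayoff σ (π i (failView i [])) = 0 := by
    rw [contPayoff_eq_integral]
    refine integral_eq_zero_of_ae (PMF.ae_of_forall_ne_zero _ ?_)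
    rintro ⟨θ, m⟩ hx
    obtain rfl : m = _ := hsupp _ hx
    refine Γ.val_eq_zero_of_safe
      (P := fun m => ∃ k, m = (List.replicate k Arm.S).map Arm.failed) θ ?_ ?_ ⟨0, rfl⟩
    · rintro _ ⟨k, rfl⟩
      exact ⟨hs k, k + 2, rfl⟩
    · rintro _ ⟨k, rfl⟩ h0
      exact absurd (hs (k + 1)) h0
  -- The deviation of a single decision maker: experiment once, and go on only after a success.
  set c : PrivHist → Prop := fun w => w = [] ∨ Sum.inl (.risky true) ∈ w with hc
  set σ' := Function.update σ i (condStrat c) with hσ'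
  have hdev : Γ.contPayoff σ' (π i (failView i [])) ≤ 0 := hzero ▸ hSE.1 i [] rfl (condStrat c)
  have hr : riskProb σ' [] = 1 := riskProb_condStrat_pos rfl (Or.inl rfl)
  have hfail : ∀ θ, Γ.next σ' (Γ.val σ') ⟨θ, [.risky false]⟩ = 0 := by
    intro θ
    have hv : ∀ y, Γ.val σ' ⟨θ, [y, .risky false]⟩ = 0 := by
      intro y
      refine val_eq_zero_of_not_cond (k := 0) ?_ (by simp [hi]) (Nat.zero_le _) ?_ θ
      · intro v a _ hv; simp only [hc, not_or] at hv ⊢; simp [hv.2]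
      · have : view i [y, .risky false] = [Sum.inr y.arm, Sum.inl (.risky false)] := by
          simp [view, hi, active_succ]
        rw [this]; simp [hc]
    exact le_antisymm (Γ.next_le fun y => (hv y).le) (Γ.le_next fun y => (hv y).ge)
  have hB : Γ.val σ' ⟨.B, []⟩ = -((1 - Γ.δ) * Γ.c) := by
    rw [val_eq_qval_risky hr]
    simp only [qval, gain, expVal, hfail]
    ring
  have hG : Γ.val σ' ⟨.G, []⟩ = (1 - Γ.δ) * Γ.g + Γ.δ * (Γ.lam * Γ.g) := by
    have h1 : Γ.next σ' (Γ.val σ') ⟨.G, [.risky true]⟩ = Γ.g :=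
      next_val_good_of_success (fun w hw => Or.inr hw) rfl
    rw [val_eq_qval_risky hr]
    simp only [qval, gain, expVal, hfail, h1]
    ring
  have h1 := (π i (failView i [])).le_integral_of_two_points (fun x => Γ.val_bound σ' x)
    (a := ⟨.B, ([] : List Arm).map Arm.failed⟩) (b := ⟨.G, ([] : List Arm).map Arm.failed⟩)
    (by simp) (k := 0) (by
      rintro ⟨θ, m⟩ hx hB hG
      obtain rfl : m = _ := hsupp _ hx
      cases θ
      · exact absurd rfl hG
      · exact absurd rfl hB)
  rw [← contPayoff_eq_integral, hC.good_eq_odds_mul] at h1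
  have h2 : Γ.val σ' ⟨.B, ([] : List Arm).map Arm.failed⟩ = _ := hB
  have h3 : Γ.val σ' ⟨.G, ([] : List Arm).map Arm.failed⟩ = _ := hG
  rw [h2, h3] at h1
  set b := (π i (failView i []) ⟨.B, ([] : List Arm).map Arm.failed⟩).toReal
  have hn : numExp [] = 0 := rfl
  rw [hn] at h1 hb
  have ho := Γ.odds_pos 0
  have hb0 : 0 < b := by
    by_contra hneg
    nlinarith [ENNReal.toReal_nonneg (a := π i (failView i []) ⟨.B, ([] : List Arm).map Arm.failed⟩)]
  have hstar : (1 - Γ.δ) * Γ.c < Γ.odds 0 * ((1 - Γ.δ) * Γ.g + Γ.δ * (Γ.lam * Γ.g)) := by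
    have hq := sub_pos.2 Γ.p0_lt_one
    have hd : 0 < Γ.c * (1 - Γ.δ) + Γ.g * (1 - Γ.δ * (1 - Γ.lam)) := by
      have h4 := mul_pos Γ.c_pos (sub_pos.2 Γ.δ_lt_one)
      have h5 : 0 < 1 - Γ.δ * (1 - Γ.lam) := by nlinarith [Γ.δ_pos, Γ.δ_lt_one, Γ.lam_pos]
      have h6 := mul_pos Γ.g_pos' h5
      linarith
    rw [pStar, div_lt_iff₀ hd] at hp
    rw [odds, pow_zero, mul_one, div_mul_eq_mul_div, lt_div_iff₀ hq]
    nlinarith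
  have := mul_lt_mul_of_pos_left hstar hb0
  nlinarith

/-- Payoff, in the good state, of a player who experiments for `d` more rounds and then waits for
the other player's reaction, if the other player had a success. -/
noncomputable def informedVal (Γ : ExpGame) : ℕ → ℝ
  | 0 => Γ.δ * Γ.g
  | d + 1 => (1 - Γ.δ) * Γ.g + Γ.δ * (Γ.lam * Γ.g + (1 - Γ.lam) * informedVal Γ d)

/-- The same payoff if the other player had no success yet, but also experiments. -/
noncomputable def uninformedVal (Γ : ExpGame) : ℕ → ℝ
  | 0 => 0
  | d + 1 => (1 - Γ.δ) * Γ.g + Γ.δ * (Γ.lam * Γ.g + (1 - Γ.lam) *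
      (Γ.lam * Γ.informedVal d + (1 - Γ.lam) * uninformedVal Γ d))

/-- The same payoff in the bad state. -/
noncomputable def lossVal (Γ : ExpGame) : ℕ → ℝ
  | 0 => 0
  | d + 1 => -((1 - Γ.δ) * Γ.c) + Γ.δ * lossVal Γ d

/-- After `k` failed rounds of the deviator, with w = (1 - λ)^k, the weights are 1 for the bad
state, Q w² for the good state without success, and Q w(1 - w) for a success of the other player.
Probing is at least as good as waiting by backward induction: one more round changes the surplus by
Q w² g `den` - (1 - δ)c plus Q w(1 - w) g (1 - δ)(1 - δ(1 - λ)), both nonnegative, besides the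
discounted surplus of the next round. -/
theorem le_total_of_high_odds {Q : ℝ} (hQ : 0 < Q) {K : ℕ}
    (hK : ∀ k < K, (1 - Γ.δ) * Γ.c ≤ Q * (1 - Γ.lam) ^ (2 * k) * (Γ.g * Γ.den)) :
    ∀ d k, k + d = K → Γ.δ * (Q * (1 - Γ.lam) ^ k * (1 - (1 - Γ.lam) ^ k)) * Γ.g ≤
      Γ.lossVal d + Q * (1 - Γ.lam) ^ (2 * k) * Γ.uninformedVal d
        + Q * (1 - Γ.lam) ^ k * (1 - (1 - Γ.lam) ^ k) * Γ.informedVal d := by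
  intro d
  induction d with
  | zero =>
    intro k _
    simp only [lossVal, uninformedVal, informedVal]
    exact le_of_eq (by ring)
  | succ d ih =>
    intro k hk
    have h1 := ih (k + 1) (by omega)
    have h2 := hK k (by omega)
    simp only [lossVal, uninformedVal, informedVal]
    have h3 : (1 - Γ.lam) ^ (2 * k) = (1 - Γ.lam) ^ k * (1 - Γ.lam) ^ k := by
      rw [two_mul, pow_add]
    have h4 : (1 - Γ.lam) ^ (2 * (k + 1))
        = (1 - Γ.lam) ^ k * (1 - Γ.lam) ^ k * ((1 - Γ.lam) * (1 - Γ.lam)) := by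
      rw [mul_add, pow_add, h3]; ring
    rw [h4, pow_succ] at h1
    rw [h3] at h2 ⊢
    have hu := sub_pos.2 Γ.lam_lt_one
    have hw0 : 0 < (1 - Γ.lam) ^ k := pow_pos hu k
    have hw1 : (1 - Γ.lam) ^ k ≤ 1 := pow_le_one₀ hu.le (by linarith [Γ.lam_pos])
    set w := (1 - Γ.lam) ^ k
    have hδ := Γ.δ_pos
    have hδ1 := sub_pos.2 Γ.δ_lt_one
    have h5 := mul_le_mul_of_nonneg_left h1 hδ.le
    have h6 : 0 ≤ Q * w * Γ.g * ((1 - w) * ((1 - Γ.δ) * (1 - Γ.δ * (1 - Γ.lam)))) := by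
      have h7 : 0 ≤ 1 - Γ.δ * (1 - Γ.lam) := by nlinarith [Γ.lam_pos]
      have := Γ.g_pos'
      have h8 : 0 ≤ 1 - w := by linarith
      positivity
    rw [den] at h2
    nlinarith

/-- Experimenting while the other player is misled into experimenting is profitable above the
encouragement cut-off. -/
theorem total_pos {Q : ℝ} (hQ : 0 < Q) {K : ℕ} (hK0 : 0 < K)
    (hQ0 : (1 - Γ.δ) * Γ.c < Q * (Γ.g * Γ.den))
    (hK : ∀ k < K, (1 - Γ.δ) * Γ.c ≤ Q * (1 - Γ.lam) ^ (2 * k) * (Γ.g * Γ.den)) :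
    0 < Γ.lossVal K + Q * Γ.uninformedVal K := by
  obtain ⟨d, rfl⟩ : ∃ d, K = d + 1 := ⟨K - 1, by omega⟩
  -- The first round is treated separately: the other player has no success yet, and the inequality
  -- `hQ0` at the initial odds is strict.
  have h1 := le_total_of_high_odds hQ hK d 1 (by omega)
  rw [pow_one, mul_one] at h1
  have h2 := mul_le_mul_of_nonneg_left h1 Γ.δ_pos.le
  simp only [lossVal, uninformedVal]
  rw [den] at hQ0
  nlinarith

/-- If after a reached history that ends with an experiment nobody experiments any more, an
experiment of the player who made it convinces the other player that the state is good. -/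
theorem riskProb_of_signal (hSE : Γ.IsSequentialEquilibrium σ π) {h : List Arm}
    (hh : Reach Γ σ (.R :: h)) (h0 : riskProb σ ((Arm.R :: h).map Arm.failed) = 0)
    (h1 : riskProb σ ((Arm.S :: .R :: h).map Arm.failed) = 0) (k : ℕ) :
    riskProb σ ((Arm.R :: addRounds (.S :: .R :: h) k).map Arm.failed) = 1 := by
  set H : List Arm := .S :: .R :: h with hH
  set i := active h.length with hi
  set j := active (h.length + 1) with hj
  have hji : j ≠ i := active_succ _
  have hu := (sub_pos.2 Γ.lam_lt_one).ne'
  have hlen : ∀ k, active (addRounds H k).length = i := fun k => by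
    rw [active_addRounds]; simp [hH, hi]
  have hlen' : ∀ k, active (Arm.R :: addRounds H k).length = j := fun k => by
    rw [List.length_cons]
    refine (eq_active_of_ne ?_).symm
    rw [hlen]; exact hji
  -- In the bad state an `R` at `H` is impossible under `σ`, and so is everything after it.
  have hwt0 : ∀ k, Γ.wt σ .B ((Arm.R :: addRounds H k).map Arm.failed) = 0 := by
    intro k
    induction k with
    | zero => rw [addRounds, wt_bad_risky, h1, mul_zero]
    | succ k ih => rw [addRounds, wt_bad_risky, wt_bad_risky, ih]; ring
  have hview : ∀ (k : ℕ) (N : List Move), view j N = view j ((addRounds H k).map Arm.failed) →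
      view j (.risky false :: N) = view j ((Arm.R :: addRounds H k).map Arm.failed) := by
    intro k N hN
    have hl : N.length = (addRounds H k).length := by
      simpa [length_view] using congrArg List.length hN
    rw [List.map_cons, view_cons_other (by rw [hl, hlen]; exact hji.symm),
      view_cons_other (by rw [List.length_map, hlen]; exact hji.symm), hN]
    rfl
  have hreached : ∀ (k : ℕ) (N : List Move), Γ.wt σ .G N ≠ 0 → Succ i N →
      view j N = view j ((addRounds H k).map Arm.failed) → Γ.wt σ .G (.risky false :: N) ≠ 0 := by
    intro k N hN hs hv
    have hl : N.length = (addRounds H k).length := by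
      simpa [length_view] using congrArg List.length hv
    rw [wt_risky, riskProb_eq_one_of_succ hSE (by rw [hl, hlen]; exact hs), mul_one]
    exact mul_ne_zero hN hu
  have hsure : ∀ (k : ℕ) (N : List Move), Γ.wt σ .G N ≠ 0 → Succ i N →
      view j N = view j ((addRounds H k).map Arm.failed) →
      riskProb σ ((Arm.R :: addRounds H k).map Arm.failed) = 1 := by
    intro k N hN hs hv
    refine Γ.riskProb_eq_one_of_sure hSE.1 (by rw [List.length_map, hlen' k])
      (fun _ => hSE.2.view_eq) fun y hy => ?_
    by_contra hG
    have hB : y.state = .B := by cases hst : y.state <;> simp_all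
    have hy' := hSE.2.eq_map_failed (h := Arm.R :: addRounds H k) hy hB
    refine hy (hSE.2.eq_zero ?_ (hview k N hv) (hreached k N hN hs hv))
    rw [hy']
    exact hwt0 k
  -- The full histories `N` in which `i` succeeded at the last experiment before `H` and all later
  -- experiments failed. They keep positive weight because `i` experiments for sure and, being
  -- convinced at each stage, so does `j`; to `j` they look like the failed history.
  have hex : ∀ k, ∃ N, Γ.wt σ .G N ≠ 0 ∧ Succ i N ∧
      view j N = view j ((addRounds H k).map Arm.failed) := by
    intro k
    induction k with
    | zero =>
      refine ⟨.safe :: .risky true :: h.map Arm.failed, ?_, Succ.cons ?_ _, ?_⟩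
      · have h2 := reach_risky_iff.1 hh
        rw [wt_safe, wt_risky, riskProb_risky true false, wt_good_failed]
        have h3 : riskProb σ (.risky false :: h.map Arm.failed) = 0 := h0
        rw [h3, sub_zero, mul_one]
        exact mul_ne_zero (mul_ne_zero (mul_ne_zero (Γ.odds_pos _).ne' h2.1) h2.2) Γ.lam_pos.ne'
      · rw [Succ, view_cons_own (by simp [hi])]; exact List.mem_cons_self
      · have h2 : active (h.map Arm.failed).length ≠ j := by
          rw [List.length_map]; exact hji.symm
        exact view_cons_congr (view_risky_other h2 true false) _
    | succ k ih =>
      obtain ⟨N, hN, hs, hv⟩ := ih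
      have hr := hsure k N hN hs hv
      have hv' := hview k N hv
      have hl : (Move.risky false :: N).length = (Arm.R :: addRounds H k).length := by
        simpa [length_view] using congrArg List.length hv'
      refine ⟨.risky false :: .risky false :: N, ?_, (hs.cons _).cons _, ?_⟩
      · have hr' : riskProb σ (.risky false :: N) = 1 := by
          rw [← hr]
          exact riskProb_congr (by rw [hl, hlen' k, hv'])
        rw [wt_risky, hr', mul_one]
        exact mul_ne_zero (hreached k N hN hs hv) hu
      · exact view_cons_congr hv' _
  obtain ⟨N, hN, hs, hv⟩ := hex k
  exact hsure k N hN hs hv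

/-- A rule for the player active after `L` moves: experiment for `K` rounds, choose `S` once, and
then go on iff the other player reacts by choosing `R`, or an experiment succeeded. -/
def Probing (L K : ℕ) (w : PrivHist) : Prop :=
  Sum.inl (.risky true) ∈ w ∨ w.length < L + 2 * K ∨ SawRisky (L + 2 * K + 1) w

/-- A successful opponent answers the final `S` with `R`, so waiting then yields δ g; with `d`
rounds still to go, an own success earns g and a failure leaves `d - 1` rounds. -/
theorem val_probing_ge_informed (hSE : Γ.IsSequentialEquilibrium σ π) {i : Player} {L K : ℕ} :
    ∀ (d : ℕ) (m : List Move), active m.length = i → m.length + 2 * d = L + 2 * K →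
      Succ (active (m.length + 1)) m →
      Γ.informedVal d ≤ Γ.val (Function.update σ i (condStrat (Probing L K))) ⟨.G, m⟩ := by
  set σ' := Function.update σ i (condStrat (Probing L K)) with hσ'
  intro d
  induction d with
  | zero =>
    intro m hi hl hs
    have hother : active (m.length + 1) ≠ i := hi ▸ active_succ _
    -- With an own success as well, the rule never stops and earns g, more than δ g.
    by_cases hsi : Succ i m
    · rw [hσ', val_good_of_succ (c := Probing L K) (fun w hw => Or.inl hw) hi hsi, informedVal]
      nlinarith [Γ.g_pos', Γ.δ_lt_one]
    · have h1 : riskProb σ' m = 0 := by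
        refine riskProb_condStrat_neg hi ?_
        rintro (h | h | h)
        · exact hsi h
        · rw [length_view] at h; omega
        · have := lt_length_of_sawRisky h
          rw [length_view] at this; omega
      have h2 : riskProb σ' (.safe :: m) = 1 := by
        rw [hσ', riskProb_update_other (by simpa using hother)]
        exact riskProb_eq_one_of_succ hSE (hs.cons _)
      have h3 : ∀ s, Γ.val σ' ⟨.G, .risky s :: .safe :: m⟩ = Γ.g := by
        intro s
        refine val_good_of_sawRisky (k := L + 2 * K + 1) (fun w hw => Or.inr (Or.inr hw))
          (by simpa using hi) ?_
        rw [view_cons_other (by simpa using hother)]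
        have h4 : (view i (.safe :: m)).length = L + 2 * K + 1 := by
          simp [length_view]; omega
        rw [← h4, sawRisky_cons_length]; rfl
      rw [val_eq_qval, h1]
      simp only [qval, next, h2, expVal, h3, informedVal]
      exact le_of_eq (by ring)
  | succ d ih =>
    intro m hi hl hs
    have h1 : riskProb σ' m = 1 :=
      riskProb_condStrat_pos hi (Or.inr (Or.inl (by rw [length_view]; omega)))
    have h2 : Γ.next σ' (Γ.val σ') ⟨.G, .risky true :: m⟩ = Γ.g :=
      next_val_good_of_success (fun w hw => Or.inl hw) hi
    have h3 : Γ.informedVal d ≤ Γ.next σ' (Γ.val σ') ⟨.G, .risky false :: m⟩ :=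
      Γ.le_next fun y => ih _ (by simpa using hi) (by simp; omega) (by
        have := (hs.cons (.risky false)).cons y
        simpa using this)
    rw [val_eq_qval_risky h1]
    simp only [qval, gain, expVal, informedVal, h2]
    have := Γ.δ_pos
    have := sub_pos.2 Γ.lam_lt_one
    gcongr

/-- Lower bounds for probing while the other player experiments. -/
theorem val_probing_ge (hSE : Γ.IsSequentialEquilibrium σ π) {i : Player} {H : List Arm} {K : ℕ}
    (hi : active H.length = i)
    (hrisk : ∀ k < K, riskProb σ ((Arm.R :: addRounds H k).map Arm.failed) = 1)
    (hend : riskProb σ ((Arm.S :: addRounds H K).map Arm.failed) = 0) :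
    ∀ d k, k + d = K →
      Γ.lossVal d ≤ Γ.val (Function.update σ i (condStrat (Probing H.length K)))
        ⟨.B, (addRounds H k).map Arm.failed⟩ ∧
      Γ.uninformedVal d ≤ Γ.val (Function.update σ i (condStrat (Probing H.length K)))
        ⟨.G, (addRounds H k).map Arm.failed⟩ := by
  set σ' := Function.update σ i (condStrat (Probing H.length K)) with hσ'
  have hact : ∀ k, active ((addRounds H k).map Arm.failed).length = i := fun k => by
    rw [List.length_map, active_addRounds, hi]
  have hother : ∀ k, active (((addRounds H k).map Arm.failed).length + 1) ≠ i := fun k => by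
    rw [← hact k]; exact active_succ _
  have hlen : ∀ k, ((addRounds H k).map Arm.failed).length = H.length + 2 * k := fun k => by
    rw [List.length_map, length_addRounds]
  intro d
  induction d with
  | zero =>
    intro k hk
    obtain rfl : k = K := by omega
    suffices hz : ∀ θ, Γ.val σ' ⟨θ, (addRounds H k).map Arm.failed⟩ = 0 from
      ⟨(hz .B).ge, (hz .G).ge⟩
    intro θ
    have h1 : riskProb σ' ((addRounds H k).map Arm.failed) = 0 := by
      refine riskProb_condStrat_neg (hact k) ?_
      rintro (h | h | h)
      · exact not_succ_failed i _ h
      · rw [length_view, hlen] at h; omega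
      · have := lt_length_of_sawRisky h
        rw [length_view, hlen] at this; omega
    have h2 : riskProb σ' (.safe :: (addRounds H k).map Arm.failed) = 0 := by
      rw [hσ', riskProb_update_other (by simpa using hother k)]
      exact hend
    have h3 : Γ.val σ' ⟨θ, .safe :: .safe :: (addRounds H k).map Arm.failed⟩ = 0 := by
      refine val_eq_zero_of_not_cond (k := H.length + 2 * k + 2) ?_ (by simpa using hact k)
        (by simp [length_addRounds]) ?_ θ
      · rintro v a hk hv (h | h | h)
        · refine hv (Or.inl ?_)
          simpa using h
        · simp only [List.length_cons] at h; omega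
        · exact hv (Or.inr (Or.inr (sawRisky_of_cons (by omega)
            (sawRisky_of_cons (by simp; omega) h))))
      · rintro (h | h | h)
        · exact not_succ_failed i (.S :: .S :: addRounds H k) h
        · rw [length_view] at h
          simp only [List.length_cons, hlen] at h; omega
        · rw [view_cons_other (by simpa using hother k)] at h
          have h4 : (view i (.safe :: (addRounds H k).map Arm.failed)).length
              = H.length + 2 * k + 1 := by
            rw [length_view, List.length_cons, hlen]
          rw [← h4, sawRisky_cons_length] at h
          simp [Move.arm] at h
    rw [val_eq_qval, h1]
    simp only [qval, next, h2, h3]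
    ring
  | succ d ih =>
    intro k hk
    obtain ⟨ihB, ihG⟩ := ih (k + 1) (by omega)
    have h1 : riskProb σ' ((addRounds H k).map Arm.failed) = 1 :=
      riskProb_condStrat_pos (hact k) (Or.inr (Or.inl (by rw [length_view, hlen]; omega)))
    have h2 : riskProb σ' (.risky false :: (addRounds H k).map Arm.failed) = 1 := by
      rw [hσ', riskProb_update_other (by simpa using hother k)]
      exact hrisk k (by omega)
    have hδ := Γ.δ_pos
    have hu := sub_pos.2 Γ.lam_lt_one
    have hlam := Γ.lam_pos
    have hm : ∀ θ, (⟨θ, (addRounds H (k + 1)).map Arm.failed⟩ : FullHist)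
        = ⟨θ, .risky false :: .risky false :: (addRounds H k).map Arm.failed⟩ := fun θ => rfl
    rw [hm] at ihB ihG
    constructor
    · rw [val_eq_qval_risky h1]
      have h3 : Γ.next σ' (Γ.val σ') ⟨.B, .risky false :: (addRounds H k).map Arm.failed⟩
          = Γ.val σ' ⟨.B, .risky false :: .risky false :: (addRounds H k).map Arm.failed⟩ := by
        simp only [next, h2, expVal]; ring
      simp only [qval, gain, expVal, h3, lossVal]
      have := mul_le_mul_of_nonneg_left ihB hδ.le
      linarith
    · rw [val_eq_qval_risky h1]
      have h3 : Γ.next σ' (Γ.val σ') ⟨.G, .risky false :: (addRounds H k).map Arm.failed⟩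
          = Γ.lam * Γ.val σ' ⟨.G, .risky true :: .risky false :: (addRounds H k).map Arm.failed⟩
          + (1 - Γ.lam) *
            Γ.val σ' ⟨.G, .risky false :: .risky false :: (addRounds H k).map Arm.failed⟩ := by
        simp only [next, h2, expVal]; ring
      have h4 : Γ.next σ' (Γ.val σ') ⟨.G, .risky true :: (addRounds H k).map Arm.failed⟩ = Γ.g :=
        next_val_good_of_success (fun w hw => Or.inl hw) (hact k)
      have h5 : Γ.informedVal d
          ≤ Γ.val σ' ⟨.G, .risky true :: .risky false :: (addRounds H k).map Arm.failed⟩ := by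
        refine val_probing_ge_informed hSE d _ (by simpa using hact k)
          (by simp only [List.length_cons, hlen]; omega) ?_
        simp only [List.length_cons, active_add_two]
        rw [Succ, view_cons_own (by simp)]
        exact List.mem_cons_self
      simp only [qval, gain, expVal, h3, h4, uninformedVal]
      gcongr

/-- Unsuccessful players cannot stop for sure right after an experiment, above the encouragement
cut-off. -/
theorem odds_le_of_forall_safe (hSE : Γ.IsSequentialEquilibrium σ π) (hR : Γ.Reasonable π)
    {h : List Arm} (hh : Reach Γ σ (.R :: h))
    (hs : ∀ k, riskProb σ ((List.replicate k Arm.S ++ .R :: h).map Arm.failed) = 0) :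
    Γ.odds (numExp (.R :: h)) * (Γ.g * Γ.den) ≤ (1 - Γ.δ) * Γ.c := by
  by_contra! hp
  set n := numExp (.R :: h) with hn
  set H : List Arm := .S :: .R :: h with hH
  have hnH : numExp H = n := numExp_safe _
  set i := active H.length with hi
  have hgd := mul_pos Γ.g_pos' Γ.den_pos
  have hcd := mul_pos (sub_pos.2 Γ.δ_lt_one) Γ.c_pos
  -- Probing lasts until the odds first fall below the cut-off: up to then each round pays, and
  -- afterwards an `S` makes an unsuccessful opponent stop, so that his reaction is informative.
  have hex : ∃ K, Γ.odds (n + 2 * K) * (Γ.g * Γ.den) < (1 - Γ.δ) * Γ.c := by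
    obtain ⟨N, hN⟩ := Γ.exists_odds_mul_lt (Γ.g * Γ.den) hcd
    exact ⟨N, (mul_le_mul_of_nonneg_right (Γ.odds_antitone (by omega)) hgd.le).trans_lt hN⟩
  classical
  set K := Nat.find hex with hK
  have hKlt := Nat.find_spec hex
  rw [← hK] at hKlt
  have hKmin : ∀ k < K, (1 - Γ.δ) * Γ.c ≤ Γ.odds (n + 2 * k) * (Γ.g * Γ.den) := fun k hk =>
    not_lt.1 (Nat.find_min hex hk)
  have hK0 : 0 < K := by
    rcases Nat.eq_zero_or_pos K with h0 | h0
    · rw [h0, mul_zero, add_zero] at hKlt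
      exact absurd hKlt hp.not_gt
    · exact h0
  have hodds : ∀ k, Γ.odds (n + 2 * k) = Γ.odds n * (1 - Γ.lam) ^ (2 * k) := fun k => by
    rw [odds, odds, pow_add]; ring
  have hpos := total_pos (Γ := Γ) (Γ.odds_pos n) hK0 hp
    (fun k hk => by rw [← hodds]; exact hKmin k hk)
  have hval := val_probing_ge hSE (i := i) (H := H) (K := K) rfl
    (fun k _ => riskProb_of_signal hSE hh (hs 0) (hs 1) k)
    (riskProb_after_safe_eq_zero hSE hR _ (by rw [numExp_addRounds, hnH]; exact hKlt))
    K 0 (by omega)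
  set σ' := Function.update σ i (condStrat (Probing H.length K)) with hσ'
  have hi' : active (H.map Arm.failed).length = i := by rw [List.length_map]
  have hbel := bad_belief_after_safe hSE.2 hR (.R :: h)
  change (π i (failView i H) ⟨.B, H.map Arm.failed⟩).toReal * (1 + Γ.odds n) = 1 at hbel
  have hzero : ∀ θ, Γ.val σ ⟨θ, H.map Arm.failed⟩ = 0 := fun θ => by
    refine Γ.val_eq_zero_of_safe
      (P := fun m => ∃ k, m = (List.replicate k Arm.S ++ .R :: h).map Arm.failed) θ ?_ ?_
      ⟨1, rfl⟩
    · rintro _ ⟨k, rfl⟩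
      exact ⟨hs k, k + 2, rfl⟩
    · rintro _ ⟨k, rfl⟩ h0
      exact absurd (hs (k + 1)) h0
  -- The crude constants `payBound` do no harm: after the `S` in `H` the mass outside the two failed
  -- histories is zero.
  have hup := (π i (failView i H)).integral_le_of_two_points (fun x => Γ.val_bound σ x)
    (a := ⟨.B, H.map Arm.failed⟩) (b := ⟨.G, H.map Arm.failed⟩) (by simp)
    (k := Γ.payBound) (fun x _ _ _ => (abs_le.1 (Γ.val_bound σ x)).2)
  have hlow := (π i (failView i H)).le_integral_of_two_points (fun x => Γ.val_bound σ' x)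
    (a := ⟨.B, H.map Arm.failed⟩) (b := ⟨.G, H.map Arm.failed⟩) (by simp)
    (k := -Γ.payBound) (fun x _ _ _ => (abs_le.1 (Γ.val_bound σ' x)).1)
  have hdev := hSE.1 i (H.map Arm.failed) hi' (condStrat (Probing H.length K))
  rw [contPayoff_eq_integral, contPayoff_eq_integral] at hdev
  rw [hSE.2.good_eq_odds_mul, hnH] at hup hlow
  rw [hzero, hzero] at hup
  have hall := hlow.trans (hdev.trans hup)
  set b := (π i (failView i H) ⟨.B, H.map Arm.failed⟩).toReal
  have hrest : 1 - b - Γ.odds n * b = 0 := by linarith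
  rw [hrest] at hall
  have hb0 : 0 < b := by
    have hb : 0 ≤ b := ENNReal.toReal_nonneg
    refine lt_of_le_of_ne hb fun hb' => ?_
    rw [← hb'] at hbel; simp at hbel
  have h1 := mul_le_mul_of_nonneg_left hval.1 hb0.le
  have h2 := mul_le_mul_of_nonneg_left hval.2 (mul_pos (Γ.odds_pos n) hb0).le
  have h3 := mul_pos hb0 hpos
  simp only [addRounds] at h1 h2
  nlinarith

/-! ### The main result -/

/-- Dropping the final choices of `S` keeps the history reached and the number of experiments
unchanged. -/
theorem exists_reach_eq_risky {h : List Arm} (hh : Reach Γ σ h) (hn : numExp h ≠ 0) :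
    ∃ h', numExp (.R :: h') = numExp h ∧ Reach Γ σ (.R :: h') := by
  induction h with
  | nil => exact absurd rfl hn
  | cons a h ih =>
    cases a
    · rw [numExp_safe] at hn ⊢
      exact ih (reach_safe_iff.1 hh).1 hn
    · exact ⟨h, rfl, hh⟩

/-- Either common beliefs fall below the cut-off and play stops, or play stops at the cut-off. -/
theorem exists_final_history (hSE : Γ.IsSequentialEquilibrium σ π) (hR : Γ.Reasonable π)
    (hp : Γ.pStar < Γ.p0) : ∃ h, Reach Γ σ h ∧ Γ.φ^[numExp h] Γ.p0 ≤ Γ.pHat ∧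
      ∀ k, riskProb σ ((List.replicate k Arm.S ++ h).map Arm.failed) = 0 := by
  have hgd := mul_pos Γ.g_pos' Γ.den_pos
  have hcd := mul_pos (sub_pos.2 Γ.δ_lt_one) Γ.c_pos
  by_cases hlow : ∃ h, Reach Γ σ h ∧ Γ.φ^[numExp h] Γ.p0 < Γ.pHat
  · obtain ⟨h, hh, hq⟩ := hlow
    obtain ⟨h', hn, hh'⟩ := exists_reach_safe hSE hR hh
    rw [phi_lt_pHat_iff] at hq
    have hq' := (mul_le_mul_of_nonneg_right (Γ.odds_antitone hn) hgd.le).trans_lt hq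
    refine ⟨.S :: h', hh', ?_, fun k => ?_⟩
    · rw [numExp_safe]; exact ((Γ.phi_lt_pHat_iff _).2 hq').le
    · have : List.replicate k Arm.S ++ Arm.S :: h' = Arm.S :: (List.replicate k Arm.S ++ h') := by
        rw [← List.cons_append, ← List.replicate_succ, List.replicate_succ', List.append_assoc]
        rfl
      rw [this]
      exact riskProb_after_safe_eq_zero hSE hR _ (by rwa [numExp_replicate_append])
  · push Not at hlow
    obtain ⟨N, hN⟩ := Γ.exists_odds_mul_lt (Γ.g * Γ.den) hcd
    have hbdd : ∀ h, Reach Γ σ h → numExp h ≤ N := by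
      intro h hh
      by_contra! hlt
      refine absurd ((Γ.phi_lt_pHat_iff _).2 ?_) (hlow h hh).not_gt
      exact (mul_le_mul_of_nonneg_right (Γ.odds_antitone hlt.le) hgd.le).trans_lt hN
    classical
    -- The number of experiments on reached histories is bounded here. At a reached history with the
    -- maximal number, a further experiment has probability zero, so `S` is chosen for ever.
    obtain ⟨h, hh, hmax⟩ : ∃ h, Reach Γ σ h ∧ ∀ h', Reach Γ σ h' → numExp h' ≤ numExp h := by
      obtain ⟨h, hh, hn⟩ := Nat.findGreatest_spec (P := fun n => ∃ h, Reach Γ σ h ∧ numExp h = n)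
        (Nat.zero_le N) ⟨[], reach_nil, rfl⟩
      exact ⟨h, hh, fun h' hh' => hn ▸ Nat.le_findGreatest (hbdd h' hh') ⟨h', hh', rfl⟩⟩
    have hforced : ∀ h', Reach Γ σ h' → numExp h' = numExp h →
        ∀ k, riskProb σ ((List.replicate k Arm.S ++ h').map Arm.failed) = 0 := by
      intro h' hh' hn k
      have hzero : ∀ h'', Reach Γ σ h'' → numExp h'' = numExp h →
          riskProb σ (h''.map Arm.failed) = 0 := by
        intro h'' hr he
        by_contra h0
        have := hmax _ (reach_risky_iff.2 ⟨hr, h0⟩)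
        rw [numExp_risky] at this; omega
      have hr : Reach Γ σ (List.replicate k .S ++ h') := by
        induction k with
        | zero => exact hh'
        | succ k ih =>
          rw [List.replicate_succ, List.cons_append, reach_safe_iff,
            hzero _ ih (by rw [numExp_replicate_append, hn])]
          exact ⟨ih, zero_ne_one⟩
      exact hzero _ hr (by rw [numExp_replicate_append, hn])
    have hn0 : numExp h ≠ 0 := by
      intro hn0
      have := hforced [] reach_nil hn0.symm
      exact not_forall_safe hSE hp (by simpa using this)
    obtain ⟨h', hn', hh'⟩ := exists_reach_eq_risky hh hn0
    refine ⟨.R :: h', hh', ?_, hforced _ hh' hn'⟩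
    have := odds_le_of_forall_safe hSE hR hh' (hforced _ hh' hn')
    exact not_lt.1 fun hlt => ((Γ.pHat_lt_phi_iff _).1 hlt).not_ge this

end ExpGame

theorem mainTheorem2 (Γ : ExpGame) (σ : ExpGame.Profile) (π : ExpGame.Beliefs)
    (hSE : Γ.IsSequentialEquilibrium σ π) (hR : Γ.Reasonable π) :
    (Γ.pStar < Γ.p0 →
      0 < Γ.playLaw σ {ω | ∀ i, ∃ ℓ ≤ Γ.pHat, ExpGame.IsFinalBelief π i ω ℓ} ∧
      ((∀ n : ℕ, Γ.φ^[n] Γ.p0 ≠ Γ.pHat) →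
        0 < Γ.playLaw σ {ω | ∀ i, ∃ ℓ < Γ.pHat, ExpGame.IsFinalBelief π i ω ℓ})) ∧
    ∀ h : List ExpGame.Arm,
      ExpGame.pubBelief π (ExpGame.active h.length) h < Γ.pHat →
        σ (ExpGame.active h.length) (ExpGame.failView (ExpGame.active h.length) h) ExpGame.Arm.R
          = 0 := by
  refine ⟨fun hp => ?_, fun h hlt => ?_⟩
  · obtain ⟨h, hh, hle, hs⟩ := ExpGame.exists_final_history hSE hR hp
    have hpos := ExpGame.finalBelief_pos hSE hh hs
    refine ⟨hpos.trans_le (measure_mono fun ω hω i => ⟨_, hle, hω i⟩), fun hne => ?_⟩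
    exact hpos.trans_le (measure_mono fun ω hω i => ⟨_, lt_of_le_of_ne hle (hne _), hω i⟩)
  · have h0 := ExpGame.riskProb_eq_zero_of_lt_pHat hSE hR h hlt
    rw [ExpGame.riskProb_failed, ENNReal.toReal_eq_zero_iff] at h0
    exact h0.resolve_right (PMF.apply_ne_top _ _)
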